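/- A lattice simplex of dimension \(d\) is the convex hull \(\mathcal P\subset\mathbb R^d\) of \(d+1\) affinely independent points of \(\mathbb Z^d\). Two sets \(\mathcal P,\mathcal Q\subset\mathbb R^d\) are unimodularly equivalent if \(\mathcal Q=\mathcal P U+\mathbf w\) for some \(U\in\mathbb Z^{d\times d}\) with \(\det U=\pm1\) and some \(\mathbf w\in\mathbb Z^d\). The \(h^*\)-polynomial of \(\mathcal P\) is the polynomial \(h^*(\mathcal P,t)\) with \[ 1+\sum_{m\ge1}|m\mathcal P\cap\mathbb Z^d|\,t^m=\frac{h^*(\mathcal P,t)}{(1-t)^{d+1}} . \] \(\mathcal P\) is a lattice pyramid if \(d\ge1\) and it is unimodularly equivalent to \(\operatorname{conv}(\mathcal Q\times\{0\},(0,\dots,0,1))\) for some lattice polytope \(\mathcal Q\subset\mathbb R^{d-1}\). \(\mathcal P\) is Gorenstein if, for some integer \(r\ge1\), \(r\mathcal P\) is unimodularly equivalent to a reflexive polytope, i.e. a lattice polytope with the origin in its interior whose dual polytope is again a lattice polytope. For integers \(v\ge2\) and \(k\ge1\), let \(N(v,k)\) be the number of unimodular equivalence classes of Gorenstein simplices (of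 arbitrary dimension) which are not lattice pyramids and whose \(h^*\)-polynomial is \(1+t^k+t^{2k}+\cdots+t^{(v-1)k}\). **Proposition.** Let \(k\ge1\) and \(\ell\ge1\) be integers and let \(p_1,\dots,p_\ell\) be distinct prime numbers. Then \(N(p_1p_2\cdots p_\ell,k)\) is finite and \[ N(p_1p_2\cdots p_\ell,k)=\sum_{s=1}^{\ell}(s!)^2\,S(\ell,s), \] where \(S(\ell,s)\) denotes the Stirling number of the second kind. -/

import Mathlib

open scoped Pointwise

noncomputable section

namespace GorensteinSimplex

/-- The inclusion `ℤ^d ⊂ ℝ^d`. -/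
def toReal {d : ℕ} (x : Fin d → ℤ) : Fin d → ℝ := fun i => (x i : ℝ)

/-- A lattice polytope in `ℝ^d`: the convex hull of finitely many (at least one) lattice points. -/
def IsLatticePolytope {d : ℕ} (P : Set (Fin d → ℝ)) : Prop :=
  ∃ V : Finset (Fin d → ℤ), V.Nonempty ∧ P = convexHull ℝ (toReal '' (V : Set (Fin d → ℤ)))

/-- A `d`-dimensional lattice simplex in `ℝ^d`: the convex hull of `d + 1` affinely independent
lattice points. -/
def IsLatticeSimplex {d : ℕ} (P : Set (Fin d → ℝ)) : Prop :=
  ∃ v : Fin (d + 1) → Fin d → ℤ,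
    AffineIndependent ℝ (fun i => toReal (v i)) ∧
      P = convexHull ℝ (Set.range fun i => toReal (v i))

/-- The map `x ↦ x U + w` of `ℝ^d`, where `x` is a row vector. -/
def affineMap {d : ℕ} (U : Matrix (Fin d) (Fin d) ℤ) (w : Fin d → ℤ) (x : Fin d → ℝ) :
    Fin d → ℝ :=
  Matrix.vecMul x (U.map (Int.cast : ℤ → ℝ)) + toReal w

/-- Unimodular equivalence: `Q = f_U(P) + w` with `U ∈ ℤ^{d × d}` of determinant `±1` and
`w ∈ ℤ^d`. -/
def UnimodularEquiv {d : ℕ} (P Q : Set (Fin d → ℝ)) : Prop :=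
  ∃ (U : Matrix (Fin d) (Fin d) ℤ) (w : Fin d → ℤ), (U.det = 1 ∨ U.det = -1) ∧
    Q = affineMap U w '' P

/-- The Ehrhart series `1 + ∑_{m ≥ 1} |mP ∩ ℤ^d| t^m`. -/
def ehrhartSeries {d : ℕ} (P : Set (Fin d → ℝ)) : PowerSeries ℤ :=
  PowerSeries.mk fun m =>
    if m = 0 then 1 else (Set.ncard {x : Fin d → ℤ | toReal x ∈ (m : ℝ) • P} : ℤ)

/-- `h` is the `h^*`-polynomial of the `d`-dimensional polytope `P ⊂ ℝ^d`, that is,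
`Ehr_P(t) (1 - t)^(d+1) = h(t)`. -/
def HasHStarPolynomial {d : ℕ} (P : Set (Fin d → ℝ)) (h : Polynomial ℤ) : Prop :=
  ehrhartSeries P * (1 - PowerSeries.X) ^ (d + 1) = (h : PowerSeries ℤ)

/-- The lattice pyramid `conv(P × {0}, (0, …, 0, 1)) ⊂ ℝ^{d+1}` over `P ⊂ ℝ^d`. -/
def pyramid {d : ℕ} (P : Set (Fin d → ℝ)) : Set (Fin (d + 1) → ℝ) :=
  convexHull ℝ
    (insert (Pi.single (Fin.last d) (1 : ℝ)) ((fun x : Fin d → ℝ => Fin.snoc x (0 : ℝ)) '' P))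

/-- Being a lattice pyramid, up to unimodular equivalence as usual. A polytope obtained by several
successive pyramids is in particular a pyramid over a polytope of dimension one less. -/
def IsLatticePyramid : {d : ℕ} → Set (Fin d → ℝ) → Prop
  | 0, _ => False
  | d + 1, P => ∃ Q : Set (Fin d → ℝ), IsLatticePolytope Q ∧ UnimodularEquiv (pyramid Q) P

/-- The dual polytope `{y : ⟨x, y⟩ ≤ 1 for all x ∈ P}`. -/
def dual {d : ℕ} (P : Set (Fin d → ℝ)) : Set (Fin d → ℝ) :=
  {y | ∀ x ∈ P, dotProduct x y ≤ 1}

/-- Reflexive polytopes. -/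
def IsReflexive {d : ℕ} (P : Set (Fin d → ℝ)) : Prop :=
  IsLatticePolytope P ∧ (0 : Fin d → ℝ) ∈ interior P ∧ IsLatticePolytope (dual P)

/-- `P` is Gorenstein if it is Gorenstein of index `r` for some `r ≥ 1`, that is, `rP` is
unimodularly equivalent to a reflexive polytope. -/
def IsGorenstein {d : ℕ} (P : Set (Fin d → ℝ)) : Prop :=
  ∃ r : ℕ, 1 ≤ r ∧ ∃ Q : Set (Fin d → ℝ), IsReflexive Q ∧ UnimodularEquiv ((r : ℝ) • P) Q

/-- The polynomial `1 + t^k + t^{2k} + ⋯ + t^{(v-1)k}`. -/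
def typePolynomial (v k : ℕ) : Polynomial ℤ :=
  ∑ i ∈ Finset.range v, Polynomial.X ^ (i * k)

/-- The `d`-dimensional Gorenstein simplices in `ℝ^d` which are not lattice pyramids and whose
`h^*`-polynomial is `1 + t^k + ⋯ + t^{(v-1)k}`. -/
def GorSimplex (v k d : ℕ) : Type :=
  {P : Set (Fin d → ℝ) // IsLatticeSimplex P ∧ IsGorenstein P ∧ ¬ IsLatticePyramid P ∧
    HasHStarPolynomial P (typePolynomial v k)}

theorem affineMap_comp {d : ℕ} (U U' : Matrix (Fin d) (Fin d) ℤ) (w w' : Fin d → ℤ)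
    (x : Fin d → ℝ) :
    affineMap U' w' (affineMap U w x) = affineMap (U * U') (Matrix.vecMul w U' + w') x := by
  have h1 : (U * U').map (Int.cast : ℤ → ℝ)
      = U.map (Int.cast : ℤ → ℝ) * U'.map (Int.cast : ℤ → ℝ) :=
    Matrix.map_mul (f := Int.castRingHom ℝ)
  have h2 : toReal (Matrix.vecMul w U' + w')
      = Matrix.vecMul (toReal w) (U'.map (Int.cast : ℤ → ℝ)) + toReal w' := by
    funext i
    simp [toReal, Matrix.vecMul, dotProduct]
  rw [affineMap, affineMap, affineMap, h1, h2, Matrix.add_vecMul, Matrix.vecMul_vecMul, add_assoc]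

theorem affineMap_one {d : ℕ} (x : Fin d → ℝ) : affineMap 1 0 x = x := by
  have h1 : (1 : Matrix (Fin d) (Fin d) ℤ).map (Int.cast : ℤ → ℝ) = 1 :=
    Matrix.map_one _ Int.cast_zero Int.cast_one
  funext i
  simp [affineMap, h1, toReal]

theorem unimodularEquiv_equivalence (d : ℕ) :
    Equivalence (UnimodularEquiv : Set (Fin d → ℝ) → Set (Fin d → ℝ) → Prop) where
  refl P := ⟨1, 0, Or.inl Matrix.det_one, by simp [funext affineMap_one]⟩
  symm := by
    rintro P Q ⟨U, w, hU, rfl⟩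
    have hu : IsUnit U.det := Int.isUnit_iff.mpr hU
    refine ⟨U⁻¹, -Matrix.vecMul w U⁻¹, Int.isUnit_iff.mp (Matrix.isUnit_nonsing_inv_det U hu), ?_⟩
    rw [Set.image_image]
    simp only [affineMap_comp, Matrix.mul_nonsing_inv U hu, add_neg_cancel, affineMap_one,
      Set.image_id']
  trans := by
    rintro P Q R ⟨U, w, hU, rfl⟩ ⟨U', w', hU', rfl⟩
    refine ⟨U * U', Matrix.vecMul w U' + w', ?_, ?_⟩
    · rw [← Int.isUnit_iff] at hU hU' ⊢
      rw [Matrix.det_mul]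
      exact hU.mul hU'
    · rw [Set.image_image]
      simp only [affineMap_comp]

/-- Unimodular equivalence on the simplices to be counted. -/
def gorSimplexSetoid (v k d : ℕ) : Setoid (GorSimplex v k d) where
  r P Q := UnimodularEquiv P.1 Q.1
  iseqv := ⟨fun P => (unimodularEquiv_equivalence d).refl P.1,
    fun h => (unimodularEquiv_equivalence d).symm h,
    fun h h' => (unimodularEquiv_equivalence d).trans h h'⟩

/-- The unimodular equivalence classes of Gorenstein simplices, of any dimension `d`, which are not
lattice pyramids and whose `h^*`-polynomial is `1 + t^k + ⋯ + t^{(v-1)k}`. -/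
def GorSimplexClass (v k : ℕ) : Type :=
  Σ d : ℕ, Quotient (gorSimplexSetoid v k d)

/-- The number `N(v, k)` of these classes. -/
def numClasses (v k : ℕ) : ℕ := Nat.card (GorSimplexClass v k)

end GorensteinSimplex

end

open scoped Pointwise

noncomputable section

namespace GorensteinSimplex

/-! Up to the order of its vertices and unimodular equivalence, a lattice simplex is determined by
the lattice of barycentric coordinate vectors of lattice points at all integral heights
(`unimodularEquiv_of_coordLattice_eq`). Its h^*-polynomial is the sum of t^(coordinate sum) over the
elements of that lattice in the half-open unit cube (`ehrhartSeries_mul`). For a Gorenstein simplex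
of positive dimension there are positive integers m_i such that the i-th coordinates lie in (1/m_i)ℤ
and the vector (1/m_i) belongs to the lattice (`exists_denominators_of_isGorenstein`). The quotient
by the integral vectors has order n = p_1 ⋯ p_ℓ. As n is squarefree, Cauchy's theorem shows that
(1/m_i) generates this quotient (`coordLattice_eq_refLattice`). Being a lattice pyramid means that
some m_i is 1. So the classes correspond to the multisets of divisors m > 1 of n for which the sums
of the fractional parts {t/m} run through 0, k, …, (n-1)k: the admissible multisets
(`classDenominators_bijective`).

To count these, let j have height k, N = gcd(n, j) and B = n/N. Heights are subadditive and distinct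
modulo n, so they grow by exactly k at each step of a chain x, x + j, …, x + (B-1)j that starts at
the minimum of its coset. No residue can carry along such a chain. This forces all members not
dividing N to be one number m'B, occurring kB times, and trading them for k copies of m' (none if m'
= 1) gives an admissible multiset for N and kB (`IsAdmissible.exists_decomposition`).

If N and B are coprime, this is reversible for m' equal to 1 or to any member of the smaller
multiset, and the data B, m' and the smaller multiset can be recovered (`IsAdmissible.extend`,
`IsAdmissible.extend_injective`). The number of distinct members rises by one. Hence the count A(n,
s) of admissible multisets with s distinct members, which does not depend on k, satisfies A(n, s+1)
= (s+1) ∑ A(n/B, s) over the divisors B ≠ 1 of n. Together with a Stirling identity this gives (s!)²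
S(ℓ, s) (`ncard_isAdmissible_card`). -/

/-! ### Heights of multisets of denominators -/

/-- The sum of the fractional parts `{t / m}` over the members `m` of a multiset. -/
def height (M : Multiset ℕ) (t : ℕ) : ℚ := (M.map fun m => ((t % m : ℕ) : ℚ) / m).sum

/-- The members of `M` are divisors of `n` other than `1` and the heights take all the values
`0, k, 2k, …, (n - 1)k`. -/
def IsAdmissible (n k : ℕ) (M : Multiset ℕ) : Prop :=
  (∀ m ∈ M, 1 < m ∧ m ∣ n) ∧ ∀ i < n, ∃ t, height M t = k * i

theorem height_add (M M' : Multiset ℕ) (t : ℕ) : height (M + M') t = height M t + height M' t := by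
  simp [height]

theorem height_cons (m : ℕ) (M : Multiset ℕ) (t : ℕ) :
    height (m ::ₘ M) t = ((t % m : ℕ) : ℚ) / m + height M t := by
  simp [height]

theorem height_replicate (c m t : ℕ) :
    height (Multiset.replicate c m) t = c * (((t % m : ℕ) : ℚ) / m) := by
  simp [height]

theorem height_nonneg (M : Multiset ℕ) (t : ℕ) : 0 ≤ height M t := by
  refine Multiset.sum_nonneg fun x hx => ?_
  obtain ⟨m, -, rfl⟩ := Multiset.mem_map.mp hx
  positivity

theorem height_zero (M : Multiset ℕ) : height M 0 = 0 := by
  simp [height]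

theorem height_congr {M : Multiset ℕ} {s t : ℕ} (h : ∀ m ∈ M, s % m = t % m) :
    height M s = height M t := by
  unfold height
  rw [Multiset.map_congr rfl]
  intro m hm
  rw [h m hm]

theorem height_modEq {M : Multiset ℕ} {n s t : ℕ} (hM : ∀ m ∈ M, m ∣ n) (h : s ≡ t [MOD n]) :
    height M s = height M t :=
  height_congr fun m hm => h.of_dvd (hM m hm)

theorem height_add_le (M : Multiset ℕ) (s t : ℕ) :
    height M (s + t) ≤ height M s + height M t := by
  induction M using Multiset.induction with
  | empty => simp [height]
  | cons m M ih =>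
    simp only [height_cons]
    have : (((s + t) % m : ℕ) : ℚ) / m ≤ ((s % m : ℕ) : ℚ) / m + ((t % m : ℕ) : ℚ) / m := by
      rw [← add_div]
      gcongr
      exact_mod_cast (Nat.add_mod s t m).trans_le (Nat.mod_le _ _)
    linarith

/-- Each summand is subadditive, so equality of the sums forces equality at every member: no residue
wraps around. -/
theorem mod_add_mod_lt_of_height_add {M : Multiset ℕ} {s t : ℕ} (hM : ∀ m ∈ M, 0 < m)
    (h : height M (s + t) = height M s + height M t) : ∀ m ∈ M, s % m + t % m < m := by
  induction M using Multiset.induction with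
  | empty => simp
  | cons m M ih =>
    simp only [height_cons] at h
    have hm : 0 < m := hM m (Multiset.mem_cons_self m M)
    have h1 : (((s + t) % m : ℕ) : ℚ) / m ≤ ((s % m : ℕ) : ℚ) / m + ((t % m : ℕ) : ℚ) / m := by
      rw [← add_div]
      gcongr
      exact_mod_cast (Nat.add_mod s t m).trans_le (Nat.mod_le _ _)
    have h2 := height_add_le M s t
    intro a ha
    rcases Multiset.mem_cons.mp ha with rfl | ha
    · have h3 : (((s + t) % a : ℕ) : ℚ) / a = ((s % a : ℕ) : ℚ) / a + ((t % a : ℕ) : ℚ) / a := by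
        linarith
      rw [← add_div, div_left_inj' (by positivity)] at h3
      have h4 : (s + t) % a = s % a + t % a := by exact_mod_cast h3
      rw [← h4]
      exact Nat.mod_lt _ hm
    · exact ih (fun m hm => hM m (Multiset.mem_cons_of_mem hm)) (by linarith) a ha

/-! ### Structure of admissible multisets -/

namespace IsAdmissible

variable {n k : ℕ} {M : Multiset ℕ}

/-- Heights depend only on t modulo n, and n prescribed distinct values are attained on n residues.
By pigeonhole nothing else is attained and nothing is repeated. -/
theorem exists_index_and_inj (h : IsAdmissible n k M) (hn : 0 < n) (hk : 0 < k) :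
    (∀ t, ∃ i < n, height M t = k * i) ∧
      ∀ s t, height M s = height M t → s ≡ t [MOD n] := by
  have hdvd : ∀ m ∈ M, m ∣ n := fun m hm => (h.1 m hm).2
  choose τ hτ using h.2
  let g : Fin n → Fin n := fun i => ⟨τ i i.2 % n, Nat.mod_lt _ hn⟩
  have hg : ∀ i : Fin n, ∀ t, (g i : ℕ) = t % n → height M t = k * (i : ℕ) := fun i t hi =>
    (height_modEq hdvd (show t ≡ τ i i.2 [MOD n] from hi.symm)).trans (hτ i i.2)
  have hkq : (k : ℚ) ≠ 0 := by positivity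
  have inj : Function.Injective g := fun i j hij => by
    have h1 := hg i (τ i i.2) rfl
    have h2 := hg j (τ i i.2) (by rw [← hij])
    rw [h1] at h2
    exact Fin.ext (by exact_mod_cast mul_left_cancel₀ hkq h2)
  have surj : Function.Surjective g := Finite.surjective_of_injective inj
  refine ⟨fun t => ?_, fun s t hst => ?_⟩
  · obtain ⟨i, hi⟩ := surj ⟨t % n, Nat.mod_lt _ hn⟩
    exact ⟨i, i.2, hg i t (by rw [hi])⟩
  · obtain ⟨i, hi⟩ := surj ⟨t % n, Nat.mod_lt _ hn⟩
    obtain ⟨j, hj⟩ := surj ⟨s % n, Nat.mod_lt _ hn⟩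
    have h1 := hg i t (by rw [hi])
    have h2 := hg j s (by rw [hj])
    rw [h1, h2] at hst
    have hij : j = i := Fin.ext (by exact_mod_cast mul_left_cancel₀ hkq hst)
    rw [hij, hi] at hj
    exact (Fin.mk.inj hj).symm

/-- If `j` has height `k` and `x` has the least height in its class modulo the multiples of `j`,
then adding `j` to `x` repeatedly increases the height by `k` each time, until one returns to the
start. -/
theorem height_add_mul (h : IsAdmissible n k M) (hn : 0 < n) (hk : 0 < k) {j B x : ℕ}
    (hj : height M j = k) (hB : ∀ s t, s < B → t < B → s * j ≡ t * j [MOD n] → s = t)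
    (hx : ∀ t, height M x ≤ height M (x + t * j)) {t : ℕ} (ht : t < B) :
    height M (x + t * j) = height M x + t * k := by
  obtain ⟨hidx, hinj⟩ := h.exists_index_and_inj hn hk
  have hkq : (0 : ℚ) < k := by positivity
  induction t using Nat.strong_induction_on with
  | _ t ih =>
    rcases Nat.eq_zero_or_pos t with rfl | htpos
    · simp
    obtain ⟨a, -, ha⟩ := hidx x
    obtain ⟨b, -, hb⟩ := hidx (x + t * j)
    have h1 : height M (x + t * j) ≤ height M x + t * k := by
      have h2 := height_add_le M (x + (t - 1) * j) j
      rw [ih (t - 1) (by omega) (by omega), hj] at h2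
      have h3 : x + (t - 1) * j + j = x + t * j := by
        obtain ⟨u, rfl⟩ : ∃ u, t = u + 1 := ⟨t - 1, by omega⟩
        simp; ring
      rw [h3] at h2
      rw [Nat.cast_sub (by omega : 1 ≤ t)] at h2
      push_cast at h2
      linarith
    have hab : a ≤ b := by
      have := hx t
      rw [ha, hb] at this
      exact_mod_cast le_of_mul_le_mul_left this hkq
    have hba : b ≤ a + t := by
      rw [ha, hb] at h1
      have : (k : ℚ) * b ≤ k * (a + t) := by linarith
      exact_mod_cast le_of_mul_le_mul_left this hkq
    rcases hba.eq_or_lt with hbt | hbt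
    · rw [ha, hb, hbt]; push_cast; ring
    -- A smaller increase would give the height already attained at the earlier point x + (b - a) *
    -- j of the chain, against injectivity modulo n.
    · exfalso
      have h2 := ih (b - a) (by omega) (by omega)
      have h3 : height M (x + (b - a) * j) = height M (x + t * j) := by
        rw [h2, ha, hb, Nat.cast_sub hab]; ring
      have h4 := hB _ _ (by omega) ht (Nat.ModEq.add_left_cancel' x (hinj _ _ h3))
      omega

end IsAdmissible

/-- Growth by exactly k at each step is equality in subadditivity, so adding j never carries and the
residues grow linearly. -/
theorem add_mul_mod_of_height {M : Multiset ℕ} {j k B x : ℕ} (hM : ∀ m ∈ M, 0 < m)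
    (hj : height M j = k) (H : ∀ t < B, height M (x + t * j) = height M x + t * k) :
    ∀ m ∈ M, ∀ t < B, (x + t * j) % m = x % m + t * (j % m) := by
  intro m hm t ht
  induction t with
  | zero => simp
  | succ t ih =>
    have h1 := H (t + 1) ht
    have h2 := H t (by omega)
    have h3 : x + (t + 1) * j = (x + t * j) + j := by ring
    have h4 := mod_add_mod_lt_of_height_add (s := x + t * j) (t := j) hM
      (by rw [← h3, h1, h2, hj]; push_cast; ring) m hm
    rw [h3, Nat.add_mod, Nat.mod_eq_of_lt h4, ih (by omega)]
    ring

/-- Replacing `k` copies of `m'` (or nothing, if `m' = 1`) by `k * B` copies of `m' * B`. -/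
theorem height_add_replicate (MN : Multiset ℕ) {k m' B : ℕ} (hm' : 0 < m') (hB : 0 < B) (y : ℕ) :
    height (MN + Multiset.replicate (k * B) (m' * B)) y =
      height (MN + if m' = 1 then 0 else Multiset.replicate k m') y + k * ((y / m' % B : ℕ) : ℚ) := by
  have h1 : height (if m' = 1 then 0 else Multiset.replicate k m') y
      = k * (((y % m' : ℕ) : ℚ) / m') := by
    split_ifs with h
    · subst h; simp [height, Nat.mod_one]
    · rw [height_replicate]
  rw [height_add, height_add, h1, height_replicate, Nat.mod_mul]
  have : (m' : ℚ) ≠ 0 := by positivity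
  have : (B : ℚ) ≠ 0 := by positivity
  push_cast
  field_simp
  ring

namespace IsAdmissible

variable {n k : ℕ} {M : Multiset ℕ}

/-- Put y = m₁ / B and start from the minimum x of the coset of y modulo multiples of j. Linear
growth modulo m₁ shows that y is not at the start of the chain. Then its residue modulo m₂, which is
y itself, would be at least j % m₂ > y. -/
theorem eq_of_dvd_mul_mod (h : IsAdmissible n k M) (hn : 0 < n) (hk : 0 < k) {j B m₁ m₂ : ℕ}
    (hj : height M j = k) (hB : ∀ s t, s < B → t < B → s * j ≡ t * j [MOD n] → s = t)
    (hB1 : 1 < B) (hBj : n ∣ B * j) (h₁ : m₁ ∈ M) (h₂ : m₂ ∈ M) (hr₁ : B * (j % m₁) = m₁)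
    (hr₂ : B * (j % m₂) = m₂) : ¬ j % m₁ < j % m₂ := by
  intro hlt
  have hpos : ∀ m ∈ M, 0 < m := fun m hm => (zero_lt_one.trans (h.1 m hm).1)
  obtain ⟨hidx, -⟩ := h.exists_index_and_inj hn hk
  set y := j % m₁ with hy
  have hex : ∃ i, ∃ t, height M (y + t * j) = k * (i : ℕ) := by
    obtain ⟨i, -, hi⟩ := hidx (y + 0 * j)
    exact ⟨i, 0, hi⟩
  classical
  obtain ⟨t₀, ht₀⟩ := Nat.find_spec hex
  set x := y + t₀ * j with hxdef
  have hx : ∀ t, height M x ≤ height M (x + t * j) := fun t => by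
    obtain ⟨i, -, hi⟩ := hidx (x + t * j)
    have h1 : x + t * j = y + (t₀ + t) * j := by rw [hxdef]; ring
    have h2 : Nat.find hex ≤ i := Nat.find_min' hex ⟨t₀ + t, by rw [← h1, hi]⟩
    rw [ht₀, hi]
    gcongr
  have H := add_mul_mod_of_height (x := x) hpos hj
    fun t ht => h.height_add_mul hn hk hj hB hx ht
  -- Multiplication by B - 1 is negation modulo B, so s cancels t₀ and y is the point number s of
  -- the chain from x.
  have hsB : ((B - 1) * t₀) % B < B := Nat.mod_lt _ (by omega)
  set s := ((B - 1) * t₀) % B with hs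
  have hst : B ∣ t₀ + s := by
    have : t₀ + s ≡ t₀ + (B - 1) * t₀ [MOD B] := Nat.ModEq.add_left _ (Nat.mod_modEq _ _)
    refine (Nat.modEq_zero_iff_dvd.mp (this.trans (Nat.modEq_zero_iff_dvd.mpr ⟨t₀, ?_⟩)))
    obtain ⟨b, rfl⟩ : ∃ b, B = b + 1 := ⟨B - 1, by omega⟩
    simp; ring
  have hxs : x + s * j ≡ y [MOD n] := by
    have h1 : x + s * j = y + (t₀ + s) * j := by rw [hxdef]; ring
    rw [h1]
    have : n ∣ (t₀ + s) * j := by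
      obtain ⟨c, hc⟩ := hst
      rw [hc, mul_right_comm]
      exact hBj.mul_right c
    simpa using Nat.ModEq.add_left y (Nat.modEq_zero_iff_dvd.mpr this)
  have e1 := H m₁ h₁ s hsB
  rw [← hy] at e1
  have e2 := H m₂ h₂ s hsB
  rw [show (x + s * j) % m₁ = y % m₁ from hxs.of_dvd (h.1 _ h₁).2] at e1
  rw [show (x + s * j) % m₂ = y % m₂ from hxs.of_dvd (h.1 _ h₂).2] at e2
  have hy1 : y < m₁ := Nat.mod_lt _ (hpos _ h₁)
  have hy2 : y < m₂ := hlt.trans (Nat.mod_lt _ (hpos _ h₂))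
  rw [Nat.mod_eq_of_lt hy1] at e1
  rw [Nat.mod_eq_of_lt hy2] at e2
  have e3 : x % m₁ + (B - 1) * y < m₁ := by
    rw [hy, ← H m₁ h₁ (B - 1) (by omega)]
    exact Nat.mod_lt _ (hpos _ h₁)
  have e4 : (B - 1) * y + y = m₁ := by
    rw [← hr₁]
    obtain ⟨b, rfl⟩ : ∃ b, B = b + 1 := ⟨B - 1, by omega⟩
    simp; ring
  rcases Nat.eq_zero_or_pos s with hs0 | hs0
  · rw [hs0] at e1
    omega
  · have := Nat.le_mul_of_pos_left (j % m₂) hs0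
    omega

/-- The structure of admissible multisets: the elements which do not divide a certain proper
divisor `N` of `n` are all equal to each other. -/
theorem exists_decomposition (h : IsAdmissible n k M) (hn : 1 < n) (hk : 0 < k) :
    ∃ N B m' : ℕ, ∃ MN : Multiset ℕ, n = N * B ∧ 1 < B ∧ m' ∣ N ∧ (∀ m ∈ MN, 1 < m ∧ m ∣ N) ∧
      M = MN + Multiset.replicate (k * B) (m' * B) ∧
      IsAdmissible N (k * B) (MN + if m' = 1 then 0 else Multiset.replicate k m') := by
  have hn0 : 0 < n := by omega
  have hpos : ∀ m ∈ M, 0 < m := fun m hm => (zero_lt_one.trans (h.1 m hm).1)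
  have hkq : (0 : ℚ) < k := by positivity
  obtain ⟨hidx, hinj⟩ := h.exists_index_and_inj hn0 hk
  obtain ⟨j, hj⟩ := h.2 1 hn
  rw [Nat.cast_one, mul_one] at hj
  obtain ⟨B, hNB⟩ := Nat.gcd_dvd_left n j
  set N := Nat.gcd n j with hN
  have hNpos : 0 < N := Nat.gcd_pos_of_pos_left _ hn0
  have hNj : N ∣ j := Nat.gcd_dvd_right n j
  have hBdef : n / N = B := by rw [hNB]; exact Nat.mul_div_cancel_left _ hNpos
  have hB0 : 0 < B := Nat.pos_of_ne_zero fun h0 => by rw [h0] at hNB; omega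
  have hB1 : 1 < B := by
    by_contra hcon
    have : B = 1 := by omega
    rw [this, mul_one] at hNB
    have h0 : height M j = height M 0 := height_modEq (fun m hm => (h.1 m hm).2)
      (Nat.modEq_zero_iff_dvd.mpr (hNB ▸ hNj))
    rw [hj, height_zero] at h0
    exact hkq.ne' h0
  have hBj : n ∣ B * j := by
    rw [hNB, mul_comm]
    exact Nat.mul_dvd_mul_left B hNj
  have hBinj : ∀ s t, s < B → t < B → s * j ≡ t * j [MOD n] → s = t := fun s t hs ht hst => by
    have := Nat.ModEq.cancel_right_div_gcd hn0 hst
    rw [← hN, hBdef] at this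
    exact this.eq_of_lt_of_lt hs ht
  have H0 := add_mul_mod_of_height (x := 0) hpos hj fun t ht =>
    h.height_add_mul hn0 hk hj hBinj (fun t => by rw [height_zero]; exact height_nonneg _ _) ht
  -- The chain from 0 gives (B - 1) * (j % m) < m, hence B * (j % m) < 2 * m. This number is a
  -- nonzero multiple of m, so it equals m.
  have dich : ∀ m ∈ M, ¬ m ∣ N → B * (j % m) = m := fun m hm hmN => by
    have h1 := H0 m hm (B - 1) (by omega)
    have h2 : (0 + (B - 1) * j) % m < m := Nat.mod_lt _ (hpos m hm)
    have h3 : j % m < m := Nat.mod_lt _ (hpos m hm)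
    have h4 : m ∣ B * (j % m) := by
      have h5 : B * (j % m) ≡ B * j [MOD m] := (Nat.mod_modEq j m).mul_left B
      exact Nat.modEq_zero_iff_dvd.mp (h5.trans (Nat.modEq_zero_iff_dvd.mpr
        ((h.1 m hm).2.trans hBj)))
    have h5 : j % m ≠ 0 := fun h0 =>
      hmN (Nat.dvd_gcd (h.1 m hm).2 (Nat.dvd_of_mod_eq_zero h0))
    obtain ⟨c, hc⟩ := h4
    have h6 : B * (j % m) = (B - 1) * (j % m) + j % m := by
      obtain ⟨b, rfl⟩ : ∃ b, B = b + 1 := ⟨B - 1, by omega⟩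
      simp; ring
    rw [Nat.zero_mod, zero_add, zero_add] at h1
    rw [zero_add] at h2
    have h7 : c < 2 := by
      by_contra hc2
      have := Nat.mul_le_mul_left m (show 2 ≤ c by omega)
      linarith
    have h8 : c ≠ 0 := fun h0 => by
      rw [h0, mul_zero] at hc
      rcases Nat.mul_eq_zero.mp hc with h9 | h9 <;> omega
    rw [hc, show c = 1 by omega, mul_one]
  have hMN : ∀ m ∈ M.filter (· ∣ N), 1 < m ∧ m ∣ N := fun m hm =>
    ⟨(h.1 m (Multiset.mem_filter.mp hm).1).1, (Multiset.mem_filter.mp hm).2⟩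
  have hsplit : M.filter (· ∣ N) + M.filter (fun m => ¬ m ∣ N) = M := Multiset.filter_add_not _ M
  have hMNj : height (M.filter (· ∣ N)) j = 0 := by
    rw [← height_zero (M.filter (· ∣ N))]
    exact height_modEq (fun m hm => (hMN m hm).2) (Nat.modEq_zero_iff_dvd.mpr hNj)
  obtain ⟨m₀, hm₀⟩ : ∃ m, m ∈ M.filter (fun m => ¬ m ∣ N) := by
    refine Multiset.exists_mem_of_ne_zero fun h0 => ?_
    rw [← hsplit, h0, add_zero, hMNj] at hj
    exact hkq.ne hj
  have hm₀M := (Multiset.mem_filter.mp hm₀).1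
  have hd₀ := dich m₀ hm₀M (Multiset.mem_filter.mp hm₀).2
  have hm'pos : 0 < j % m₀ := Nat.pos_of_ne_zero fun h0 => by
    rw [h0, mul_zero] at hd₀
    exact (hpos m₀ hm₀M).ne hd₀
  have hrest : ∀ m ∈ M.filter (fun m => ¬ m ∣ N), m = m₀ := fun m hm => by
    obtain ⟨hmM, hmN⟩ := Multiset.mem_filter.mp hm
    have hd := dich m hmM hmN
    have h1 := h.eq_of_dvd_mul_mod hn0 hk hj hBinj hB1 hBj hmM hm₀M hd hd₀
    have h2 := h.eq_of_dvd_mul_mod hn0 hk hj hBinj hB1 hBj hm₀M hmM hd₀ hd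
    rw [← hd, ← hd₀, le_antisymm (not_lt.mp h2) (not_lt.mp h1)]
  obtain ⟨c, hc⟩ : ∃ c, M.filter (fun m => ¬ m ∣ N) = Multiset.replicate c m₀ :=
    ⟨_, Multiset.eq_replicate_card.mpr hrest⟩
  set m' := j % m₀ with hm'
  set MN := M.filter (· ∣ N) with hMNdef
  have hBq : (B : ℚ) ≠ 0 := by positivity
  have hm'q : (m' : ℚ) ≠ 0 := by positivity
  -- The divisors of N contribute nothing to the height k of j, and each of the c copies of m₀
  -- contributes 1 / B.
  have hcB : c = k * B := by
    have h1 := hj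
    rw [← hsplit, height_add, hMNj, hc, height_replicate, ← hm', ← hd₀] at h1
    push_cast at h1
    field_simp at h1
    have h2 : (c : ℚ) = ((k * B : ℕ) : ℚ) := by push_cast; linarith
    exact_mod_cast h2
  have hM : M = MN + Multiset.replicate (k * B) (m' * B) := by
    rw [← hcB, mul_comm m' B, hd₀, ← hc, hsplit]
  have hm'N : m' ∣ N := by
    have h1 := (h.1 m₀ hm₀M).2
    rw [← hd₀, hNB, mul_comm N B] at h1
    exact Nat.dvd_of_mul_dvd_mul_left hB0 h1
  have hM'N : ∀ m ∈ MN + (if m' = 1 then 0 else Multiset.replicate k m'), 1 < m ∧ m ∣ N := by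
    intro m hm
    rcases Multiset.mem_add.mp hm with hm | hm
    · exact hMN m hm
    · split_ifs at hm with h1
      · simp at hm
      · rw [Multiset.eq_of_mem_replicate hm]
        exact ⟨by omega, hm'N⟩
  refine ⟨N, B, m', MN, hNB, hB1, hm'N, hMN, hM, hM'N, ?_⟩
  have hform := fun y => height_add_replicate MN (k := k) hm'pos hB0 y
  rw [← hM] at hform
  -- Since j ≡ m' modulo m' * B, adding j raises the base-B digit of y / m' by one.
  have hdig : ∀ y t, (y + t * j) / m' % B = (y / m' + t) % B := fun y t => by
    have h1 : j = m' + m' * B * (j / m₀) := by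
      rw [mul_comm m' B, hd₀, hm']
      exact (Nat.mod_add_div j m₀).symm
    have h2 : (y + t * j) / m' = y / m' + t + B * (t * (j / m₀)) := by
      conv_lhs => rw [h1]
      rw [show y + t * (m' + m' * B * (j / m₀)) = y + m' * (t + B * (t * (j / m₀))) by ring,
        Nat.add_mul_div_left _ _ hm'pos]
      ring
    rw [h2, Nat.add_mul_mod_self_left]
  have hM'j : ∀ y t, height (MN + if m' = 1 then 0 else Multiset.replicate k m') (y + t * j) =
      height (MN + if m' = 1 then 0 else Multiset.replicate k m') y := fun y t =>
    height_modEq (fun m hm => (hM'N m hm).2) (by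
      simpa using Nat.ModEq.add_left y (Nat.modEq_zero_iff_dvd.mpr (hNj.mul_left t)))
  -- Heights that are multiples of k * B occur at digit 0. Otherwise adding (B - 1) * j to y lowers
  -- its digit by one, while at the previous level y' it raises the digit 0 to B - 1. Both results
  -- have height k * ((q + 1) * B - 1), so y ≡ y', which is absurd.
  have key : ∀ q < N, ∃ y, height M y = k * (q * B : ℕ) ∧ y / m' % B = 0 := by
    intro q
    induction q with
    | zero => exact fun _ => ⟨0, by simp [height_zero]⟩
    | succ q ih =>
      intro hq
      obtain ⟨y', hy', hd'⟩ := ih (by omega)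
      obtain ⟨y, hy⟩ := h.2 ((q + 1) * B) (by rw [hNB]; exact Nat.mul_lt_mul_of_pos_right hq hB0)
      refine ⟨y, hy, ?_⟩
      by_contra hd
      have hdB : y / m' % B < B := Nat.mod_lt _ hB0
      have e1 : (y / m' + (B - 1)) % B = y / m' % B - 1 := by
        rw [← Nat.mod_add_mod, show y / m' % B + (B - 1) = (y / m' % B - 1) + B by omega,
          Nat.add_mod_right, Nat.mod_eq_of_lt (by omega)]
      have e2 : (y' / m' + (B - 1)) % B = B - 1 := by
        rw [← Nat.mod_add_mod, hd', zero_add, Nat.mod_eq_of_lt (by omega)]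
      have f1 := hform (y + (B - 1) * j)
      have f2 := hform (y' + (B - 1) * j)
      rw [hM'j, hdig, e1, Nat.cast_sub (by omega)] at f1
      rw [hM'j, hdig, e2, Nat.cast_sub (by omega)] at f2
      have g1 := hform y
      have g2 := hform y'
      rw [hd', hy'] at g2
      rw [hy] at g1
      push_cast at f1 f2 g1 g2
      have heq : height M (y + (B - 1) * j) = height M (y' + (B - 1) * j) := by
        rw [f1, f2]; linarith
      have h3 := Nat.ModEq.add_right_cancel' _ (hinj _ _ heq)
      have h4 : height M y = height M y' := height_modEq (fun m hm => (h.1 m hm).2) h3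
      rw [hy, hy'] at h4
      have h5 := mul_left_cancel₀ hkq.ne' h4
      have h6 : (q + 1) * B = q * B := by exact_mod_cast h5
      rw [add_mul] at h6
      omega
  intro q hq
  obtain ⟨y, hy, hd⟩ := key q hq
  refine ⟨y, ?_⟩
  have := hform y
  rw [hd, hy] at this
  push_cast at this ⊢
  linarith

end IsAdmissible

/-! ### Reversing the decomposition -/

/-- Replace `k` copies of `m'` (no copies, if `m' = 1`) by `k * B` copies of `m' * B`. -/
def extend (k B m' : ℕ) (M : Multiset ℕ) : Multiset ℕ :=
  M - Multiset.replicate k m' + Multiset.replicate (k * B) (m' * B)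

/-- Truncated subtraction removes nothing when m' = 1, because 1 is not a member. This treats both
cases uniformly. -/
theorem extend_add {k B m' : ℕ} {MN : Multiset ℕ} (h1 : 1 ∉ MN) :
    extend k B m' (MN + if m' = 1 then 0 else Multiset.replicate k m') =
      MN + Multiset.replicate (k * B) (m' * B) := by
  unfold extend
  congr 1
  split_ifs with h
  · subst h
    ext a
    rw [Multiset.count_sub, add_zero, Multiset.count_replicate]
    split_ifs with h
    · rw [Multiset.count_eq_zero_of_notMem (h ▸ h1)]
      omega
    · omega
  · simp

theorem sub_replicate_add {k m' : ℕ} {M : Multiset ℕ} (h1 : 1 ∉ M)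
    (hc : m' = 1 ∨ k ≤ M.count m') :
    (M - Multiset.replicate k m') + (if m' = 1 then 0 else Multiset.replicate k m') = M := by
  split_ifs with h
  · subst h
    ext a
    rw [add_zero, Multiset.count_sub, Multiset.count_replicate]
    split_ifs with h
    · rw [Multiset.count_eq_zero_of_notMem (h ▸ h1)]
      omega
    · omega
  · exact tsub_add_cancel_of_le (Multiset.le_count_iff_replicate_le.mp (hc.resolve_left h))

theorem one_notMem_of_forall {N : ℕ} {M : Multiset ℕ} (h : ∀ m ∈ M, 1 < m ∧ m ∣ N) : 1 ∉ M :=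
  fun hm => lt_irrefl _ (h 1 hm).1

namespace IsAdmissible

/-- Induction along the decomposition: in the smaller multiset every multiplicity is at least k * B
≥ 2 * k, and at most k copies are traded away. -/
theorem le_count {n k : ℕ} {M : Multiset ℕ} (h : IsAdmissible n k M) (hn : 0 < n) (hk : 0 < k)
    {m : ℕ} (hm : m ∈ M) : k ≤ M.count m := by
  induction n using Nat.strong_induction_on generalizing k M m with
  | _ n ih =>
    have hn1 : 1 < n := (h.1 m hm).1.trans_le (Nat.le_of_dvd hn (h.1 m hm).2)
    obtain ⟨N, B, m', MN, rfl, hB, hm'N, hMN, rfl, hM'⟩ := h.exists_decomposition hn1 hk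
    have hN : 0 < N := Nat.pos_of_mul_pos_right hn
    have hNlt : N < N * B := (Nat.lt_mul_iff_one_lt_right hN).mpr hB
    have hk2 : k + k ≤ k * B := by
      have := Nat.mul_le_mul_left k (show 2 ≤ B from hB)
      omega
    rw [Multiset.count_add]
    rcases Multiset.mem_add.mp hm with h1 | h1
    · have h2 := ih N hNlt hM' hN (Nat.mul_pos hk (by omega))
        (Multiset.mem_add.mpr (Or.inl h1))
      rw [Multiset.count_add] at h2
      have h3 : Multiset.count m (if m' = 1 then 0 else Multiset.replicate k m') ≤ k := by
        split_ifs
        · simp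
        · rw [Multiset.count_replicate]
          split_ifs <;> omega
      omega
    · rw [Multiset.eq_of_mem_replicate h1, Multiset.count_replicate_self]
      omega

variable {N B k m' : ℕ} {M : Multiset ℕ}

/-- With 2 * k copies of m' available, removing k of them is a genuine subtraction and loses no
value. -/
theorem le_count_of_insert (h : IsAdmissible N (k * B) M) (hN : 0 < N) (hk : 0 < k) (hB : 1 < B)
    (hm' : m' ∈ insert 1 M.toFinset) : m' = 1 ∨ k + k ≤ M.count m' := by
  rcases Finset.mem_insert.mp hm' with h1 | h1
  · exact Or.inl h1
  · right
    have h2 := h.le_count hN (Nat.mul_pos hk (by omega)) (Multiset.mem_toFinset.mp h1)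
    have := Nat.mul_le_mul_left k (show 2 ≤ B from hB)
    omega

theorem dvd_of_insert (h : IsAdmissible N (k * B) M) (hm' : m' ∈ insert 1 M.toFinset) :
    m' ∣ N := by
  rcases Finset.mem_insert.mp hm' with rfl | h1
  · exact one_dvd N
  · exact (h.1 m' (Multiset.mem_toFinset.mp h1)).2

theorem height_extend (h : IsAdmissible N (k * B) M) (hN : 0 < N) (hk : 0 < k) (hB : 1 < B)
    (hm' : m' ∈ insert 1 M.toFinset) (y : ℕ) :
    height (extend k B m' M) y = height M y + k * ((y / m' % B : ℕ) : ℚ) := by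
  have h1 := h.le_count_of_insert hN hk hB hm'
  have h2 := sub_replicate_add (k := k) (one_notMem_of_forall h.1) (h1.imp_right fun h => by omega)
  have hpos : 0 < m' := Nat.pos_of_dvd_of_pos (h.dvd_of_insert hm') hN
  unfold extend
  rw [height_add_replicate _ hpos (by omega), h2]

/-- Adding N shifts y / m' by N / m', which is invertible modulo B, so every digit is reached
without changing y modulo N. -/
theorem exists_digit (hcop : Nat.Coprime N B) (hB : 1 < B) (hm' : m' ∣ N) (hN : 0 < N) (y : ℕ)
    {e : ℕ} (he : e < B) : ∃ s, (y + s * N) / m' % B = e := by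
  have hm'pos : 0 < m' := Nat.pos_of_dvd_of_pos hm' hN
  obtain ⟨c, rfl⟩ := hm'
  have hc : Nat.Coprime c B := hcop.coprime_dvd_left (dvd_mul_left c m')
  obtain ⟨b, -, hb⟩ := Nat.exists_mul_mod_eq_one_of_coprime hc hB
  refine ⟨b * (e + (B - 1) * (y / m')), ?_⟩
  rw [show y + b * (e + (B - 1) * (y / m')) * (m' * c) =
    y + m' * (c * b * (e + (B - 1) * (y / m'))) by ring, Nat.add_mul_div_left _ _ hm'pos]
  have h1 : c * b * (e + (B - 1) * (y / m')) ≡ 1 * (e + (B - 1) * (y / m')) [MOD B] :=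
    Nat.ModEq.mul_right _ (by rw [Nat.ModEq, hb, Nat.mod_eq_of_lt hB])
  have h2 := h1.add_left (y / m')
  have h3 : y / m' + 1 * (e + (B - 1) * (y / m')) = e + B * (y / m') := by
    obtain ⟨b, rfl⟩ : ∃ b, B = b + 1 := ⟨B - 1, by omega⟩
    simp; ring
  rw [h3] at h2
  rw [h2, Nat.add_mul_mod_self_left, Nat.mod_eq_of_lt he]

/-- Write i = B * (i / B) + i % B: the residue modulo N supplies the quotient, and the digit is then
adjusted independently to the remainder. -/
theorem extend (h : IsAdmissible N (k * B) M) (hN : 0 < N) (hk : 0 < k) (hB : 1 < B)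
    (hcop : Nat.Coprime N B) (hm' : m' ∈ insert 1 M.toFinset) :
    IsAdmissible (N * B) k (extend k B m' M) := by
  have hm'N := h.dvd_of_insert hm'
  have hpos : 0 < m' := Nat.pos_of_dvd_of_pos hm'N hN
  refine ⟨fun m hm => ?_, fun i hi => ?_⟩
  · rcases Multiset.mem_add.mp hm with h1 | h1
    · have := h.1 m (Multiset.mem_of_le tsub_le_self h1)
      exact ⟨this.1, this.2.mul_right B⟩
    · rw [Multiset.eq_of_mem_replicate h1]
      exact ⟨by nlinarith, Nat.mul_dvd_mul_right hm'N B⟩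
  · obtain ⟨y, hy⟩ := h.2 (i / B) (Nat.div_lt_of_lt_mul (by rwa [mul_comm]))
    obtain ⟨s, hs⟩ := exists_digit hcop hB hm'N hN y (Nat.mod_lt i (by omega : 0 < B))
    refine ⟨y + s * N, ?_⟩
    have h1 : height M (y + s * N) = height M y := height_modEq (fun m hm => (h.1 m hm).2) (by
      simp [Nat.ModEq])
    rw [h.height_extend hN hk hB hm', hs, h1, hy]
    have h2 : (i : ℚ) = ((B * (i / B) + i % B : ℕ) : ℚ) := by rw [Nat.div_add_mod]
    rw [h2]
    push_cast
    ring

theorem toFinset_extend (h : IsAdmissible N (k * B) M) (hN : 0 < N) (hk : 0 < k) (hB : 1 < B)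
    (hm' : m' ∈ insert 1 M.toFinset) :
    (GorensteinSimplex.extend k B m' M).toFinset = insert (m' * B) M.toFinset := by
  have h1 := h.le_count_of_insert hN hk hB hm'
  have hkB : 0 < k * B := Nat.mul_pos hk (by omega)
  have hone := one_notMem_of_forall h.1
  ext a
  rw [Finset.mem_insert, Multiset.mem_toFinset, Multiset.mem_toFinset, GorensteinSimplex.extend,
    Multiset.mem_add, Multiset.mem_replicate, or_comm]
  refine or_congr ⟨And.right, fun h => ⟨hkB.ne', h⟩⟩
    ⟨fun h => Multiset.mem_of_le tsub_le_self h, fun ha => ?_⟩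
  rw [← Multiset.count_pos, Multiset.count_sub, Multiset.count_replicate]
  have := Multiset.count_pos.mpr ha
  split_ifs with h2
  · subst h2
    rcases h1 with rfl | h1
    · exact absurd ha hone
    · omega
  · omega

theorem not_mul_dvd (hB : 1 < B) (hcop : Nat.Coprime N B) : ¬ m' * B ∣ N := fun h => by
  have := Nat.eq_one_of_dvd_coprimes hcop ((dvd_mul_left B m').trans h) dvd_rfl
  omega

theorem card_toFinset_extend (h : IsAdmissible N (k * B) M) (hN : 0 < N) (hk : 0 < k) (hB : 1 < B)
    (hcop : Nat.Coprime N B) (hm' : m' ∈ insert 1 M.toFinset) :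
    (GorensteinSimplex.extend k B m' M).toFinset.card = M.toFinset.card + 1 := by
  rw [h.toFinset_extend hN hk hB hm', Finset.card_insert_of_notMem]
  exact fun h1 => not_mul_dvd hB hcop (h.1 _ (Multiset.mem_toFinset.mp h1)).2

/-- The residue of height k is unique modulo n and its gcd with n is N, so N and B are determined.
Then m' * B is the only member not dividing N, which gives m', and cancellation gives the smaller
multiset. -/
theorem extend_injective {B₁ B₂ N₁ N₂ m₁ m₂ : ℕ} {M₁ M₂ : Multiset ℕ}
    (h₁ : IsAdmissible N₁ (k * B₁) M₁) (h₂ : IsAdmissible N₂ (k * B₂) M₂)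
    (hN₁ : 0 < N₁) (hN₂ : 0 < N₂) (hk : 0 < k) (hB₁ : 1 < B₁) (hB₂ : 1 < B₂)
    (hc₁ : Nat.Coprime N₁ B₁) (hc₂ : Nat.Coprime N₂ B₂)
    (hm₁ : m₁ ∈ insert 1 M₁.toFinset) (hm₂ : m₂ ∈ insert 1 M₂.toFinset)
    (hN : N₁ * B₁ = N₂ * B₂)
    (heq : GorensteinSimplex.extend k B₁ m₁ M₁ = GorensteinSimplex.extend k B₂ m₂ M₂) :
    B₁ = B₂ ∧ M₁ = M₂ ∧ m₁ = m₂ := by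
  have main : ∀ {N B m' : ℕ} {M : Multiset ℕ}, IsAdmissible N (k * B) M → 0 < N → 1 < B →
      Nat.Coprime N B → m' ∈ insert 1 M.toFinset →
      ∃ j, height (GorensteinSimplex.extend k B m' M) j = k ∧ Nat.gcd j (N * B) = N := by
    intro N B m' M h hN hB hc hm
    have hmN := h.dvd_of_insert hm
    obtain ⟨s, hs⟩ := exists_digit hc hB hmN hN 0 hB
    refine ⟨s * N, ?_, ?_⟩
    · rw [zero_add] at hs
      have h0 : height M (s * N) = height M 0 := height_modEq (fun m hm => (h.1 m hm).2) (by
        simp [Nat.ModEq])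
      rw [h.height_extend hN hk hB hm, hs, h0, height_zero]
      simp
    · rw [mul_comm s, Nat.gcd_mul_left]
      -- Digit 1 at s * N says that s * (N / m') ≡ 1 modulo B.
      have : Nat.Coprime s B := by
        obtain ⟨c, hc⟩ := hmN
        rw [zero_add, hc, mul_left_comm, Nat.mul_div_cancel_left _
          (Nat.pos_of_dvd_of_pos ⟨c, hc⟩ hN)] at hs
        have h2 : Nat.gcd s B ∣ 1 := by
          rw [← hs]
          exact (Nat.dvd_mod_iff (Nat.gcd_dvd_right s B)).mpr
            ((Nat.gcd_dvd_left s B).mul_right c)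
        exact Nat.dvd_one.mp h2
      rw [this.gcd_eq_one, mul_one]
  obtain ⟨j₁, hj₁, hg₁⟩ := main h₁ hN₁ hB₁ hc₁ hm₁
  obtain ⟨j₂, hj₂, hg₂⟩ := main h₂ hN₂ hB₂ hc₂ hm₂
  have hadm := h₁.extend hN₁ hk hB₁ hc₁ hm₁
  have hinj := (hadm.exists_index_and_inj (Nat.mul_pos hN₁ (by omega)) hk).2
  have hNN : N₁ = N₂ := by
    rw [← hg₁, ← hg₂, ← hN]
    exact (hinj j₁ j₂ (by rw [hj₁, heq, hj₂])).gcd_eq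
  subst hNN
  have hBB : B₁ = B₂ := Nat.eq_of_mul_eq_mul_left hN₁ hN
  subst hBB
  have hmm : m₁ = m₂ := by
    have h3 : m₁ * B₁ ∈ insert (m₂ * B₁) M₂.toFinset := by
      rw [← h₂.toFinset_extend hN₂ hk hB₂ hm₂, ← heq, h₁.toFinset_extend hN₁ hk hB₁ hm₁]
      exact Finset.mem_insert_self _ _
    rcases Finset.mem_insert.mp h3 with h4 | h4
    · exact Nat.eq_of_mul_eq_mul_right (by omega) h4
    · exact absurd (h₂.1 _ (Multiset.mem_toFinset.mp h4)).2 (not_mul_dvd hB₁ hc₁)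
  subst hmm
  refine ⟨rfl, ?_, rfl⟩
  rw [← sub_replicate_add (one_notMem_of_forall h₁.1)
    ((h₁.le_count_of_insert hN₁ hk hB₁ hm₁).imp_right fun h => (by omega : k ≤ M₁.count m₁)),
    ← sub_replicate_add (one_notMem_of_forall h₂.1)
    ((h₂.le_count_of_insert hN₂ hk hB₂ hm₂).imp_right fun h => (by omega : k ≤ M₂.count m₁)),
    add_right_cancel heq]

/-- Admissible multisets arise by `extend` from those for a proper divisor. -/
theorem exists_extend {n : ℕ} (h : IsAdmissible n k M) (hn : 1 < n) (hk : 0 < k) :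
    ∃ N B m' : ℕ, ∃ M' : Multiset ℕ, n = N * B ∧ 1 < B ∧ IsAdmissible N (k * B) M' ∧
      m' ∈ insert 1 M'.toFinset ∧ GorensteinSimplex.extend k B m' M' = M := by
  obtain ⟨N, B, m', MN, hN, hB, hm'N, hMN, hM, hM'⟩ := h.exists_decomposition hn hk
  refine ⟨N, B, m', _, hN, hB, hM', ?_, ?_⟩
  · rw [Finset.mem_insert, Multiset.mem_toFinset, Multiset.mem_add]
    by_cases h1 : m' = 1
    · exact Or.inl h1
    · exact Or.inr (Or.inr (by simpa [h1, Multiset.mem_replicate] using hk.ne'))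
  · rw [extend_add (one_notMem_of_forall hMN), hM]

end IsAdmissible

theorem isAdmissible_one_iff {k : ℕ} {M : Multiset ℕ} : IsAdmissible 1 k M ↔ M = 0 := by
  constructor
  · intro h
    refine Multiset.eq_zero_of_forall_notMem fun m hm => ?_
    have := h.1 m hm
    rw [Nat.dvd_one] at this
    omega
  · rintro rfl
    refine ⟨by simp, fun i hi => ⟨0, ?_⟩⟩
    rw [Nat.lt_one_iff.mp hi]
    simp [height]

/-! ### Stirling numbers and the count of admissible multisets -/

/-- In a partition of l + 1 points, i counts the points outside the block of the extra point. The
proof is an induction by Pascal's rule. -/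
theorem sum_choose_mul_stirlingSecond (l s : ℕ) :
    ∑ i ∈ Finset.range (l + 1), l.choose i * Nat.stirlingSecond i s =
      Nat.stirlingSecond (l + 1) (s + 1) := by
  induction l generalizing s with
  | zero => cases s <;> simp [Nat.stirlingSecond]
  | succ l ih =>
    rw [Finset.sum_range_succ']
    have h1 : ∀ i, (l + 1).choose (i + 1) * Nat.stirlingSecond (i + 1) s =
        l.choose i * Nat.stirlingSecond (i + 1) s +
          l.choose (i + 1) * Nat.stirlingSecond (i + 1) s := fun i => by
      rw [Nat.choose_succ_succ, add_mul]
    simp only [h1, Finset.sum_add_distrib]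
    have h2 : ∑ i ∈ Finset.range (l + 1), l.choose (i + 1) * Nat.stirlingSecond (i + 1) s +
        (l + 1).choose 0 * Nat.stirlingSecond 0 s = Nat.stirlingSecond (l + 1) (s + 1) := by
      rw [← ih s, Finset.sum_range_succ' (fun i => l.choose i * Nat.stirlingSecond i s) l,
        Finset.sum_range_succ]
      simp
    rw [add_assoc, h2, Nat.stirlingSecond_succ_succ (l + 1) s]
    cases s with
    | zero => simp [Nat.stirlingSecond_succ_zero]
    | succ s =>
      have h3 : ∀ i, l.choose i * Nat.stirlingSecond (i + 1) (s + 1) =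
          (s + 1) * (l.choose i * Nat.stirlingSecond i (s + 1)) +
            l.choose i * Nat.stirlingSecond i s := fun i => by
        rw [Nat.stirlingSecond_succ_succ]; ring
      simp only [h3, Finset.sum_add_distrib, ← Finset.mul_sum, ih]
      ring

/-- Divisors of a squarefree n are subsets of its primes, so the full sum is S(ℓ + 1, s + 1). The
term B = 1 is the summand S(ℓ, s) of its recurrence. -/
theorem sum_divisors_erase_stirlingSecond {n : ℕ} (hn : Squarefree n) (s : ℕ) :
    ∑ B ∈ n.divisors.erase 1, Nat.stirlingSecond (n / B).primeFactors.card s =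
      (s + 1) * Nat.stirlingSecond n.primeFactors.card (s + 1) := by
  have h0 : ∑ B ∈ n.divisors, Nat.stirlingSecond (n / B).primeFactors.card s =
      Nat.stirlingSecond (n.primeFactors.card + 1) (s + 1) := by
    rw [Nat.sum_div_divisors n fun d => Nat.stirlingSecond d.primeFactors.card s,
      ← Nat.divisors_filter_squarefree_of_squarefree hn,
      Nat.sum_divisors_filter_squarefree hn.ne_zero]
    have h1 : (UniqueFactorizationMonoid.normalizedFactors n).toFinset = n.primeFactors := by
      ext p; simp [Nat.factors_eq]
    rw [h1, ← sum_choose_mul_stirlingSecond]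
    simp only [← smul_eq_mul]
    rw [← Finset.sum_powerset_apply_card (fun i => Nat.stirlingSecond i s)]
    refine Finset.sum_congr rfl fun t ht => ?_
    have h2 : t.val.prod = ∏ p ∈ t, p := by simp
    rw [h2, Nat.primeFactors_prod fun p hp => Nat.prime_of_mem_primeFactors
      (Finset.mem_powerset.mp ht hp)]
  rw [← Finset.add_sum_erase _ _ (Nat.one_mem_divisors.mpr hn.ne_zero), Nat.div_one,
    Nat.stirlingSecond_succ_succ] at h0
  omega

/-- Induction on the number s of distinct members, for all n and k at once because a reduction
replaces k by k * B. -/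
theorem ncard_isAdmissible_card (s : ℕ) : ∀ n k : ℕ, Squarefree n → 0 < k →
    {M | IsAdmissible n k M ∧ M.toFinset.card = s}.Finite ∧
    {M | IsAdmissible n k M ∧ M.toFinset.card = s}.ncard =
      s.factorial ^ 2 * Nat.stirlingSecond n.primeFactors.card s := by
  induction s with
  | zero =>
    intro n k hn hk
    have h0 : {M | IsAdmissible n k M ∧ M.toFinset.card = 0} = if n = 1 then {0} else ∅ := by
      ext M
      simp only [Finset.card_eq_zero, Multiset.toFinset_eq_empty, Set.mem_ofPred_eq]
      split_ifs with h1
      · subst h1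
        rw [isAdmissible_one_iff, and_self, Set.mem_singleton_iff]
      · simp only [Set.mem_empty_iff_false, iff_false, not_and]
        rintro ⟨-, h2⟩ rfl
        have : 1 < n := by have := hn.ne_zero; omega
        obtain ⟨t, ht⟩ := h2 1 this
        simp only [height, Multiset.map_zero, Multiset.sum_zero, Nat.cast_one, mul_one] at ht
        exact hk.ne (by exact_mod_cast ht)
    rw [h0]
    split_ifs with h1
    · simp [h1]
    · have : n.primeFactors.card ≠ 0 := by
        rw [Finset.card_ne_zero, Nat.nonempty_primeFactors]
        have := hn.ne_zero; omega
      obtain ⟨c, hc⟩ := Nat.exists_eq_succ_of_ne_zero this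
      simp [hc, Nat.stirlingSecond_succ_zero]
  | succ s ih =>
    intro n k hn hk
    have hn0 := Nat.pos_of_ne_zero hn.ne_zero
    have hD : ∀ B ∈ n.divisors.erase 1, n / B * B = n ∧ 1 < B ∧ 0 < n / B ∧
        Nat.Coprime (n / B) B ∧ Squarefree (n / B) := fun B hB => by
      obtain ⟨hB1, hB⟩ := Finset.mem_erase.mp hB
      have hd := Nat.dvd_of_mem_divisors hB
      have h1 := Nat.div_mul_cancel hd
      have h2 := Nat.pos_of_dvd_of_pos hd hn0
      refine ⟨h1, by omega, Nat.div_pos (Nat.le_of_dvd hn0 hd) h2, ?_,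
        hn.squarefree_of_dvd (Nat.div_dvd_of_dvd hd)⟩
      exact Nat.coprime_of_squarefree_mul (by rwa [h1])
    have hF : ∀ B, B ∈ n.divisors.erase 1 → ∃ F : Finset (Multiset ℕ),
        (∀ M, M ∈ F ↔ IsAdmissible (n / B) (k * B) M ∧ M.toFinset.card = s) ∧
          F.card = s.factorial ^ 2 * Nat.stirlingSecond (n / B).primeFactors.card s := by
      intro B hB
      obtain ⟨h1, h2⟩ := ih (n / B) (k * B) (hD B hB).2.2.2.2
        (Nat.mul_pos hk (by have := (hD B hB).2.1; omega))
      exact ⟨h1.toFinset, fun M => by simp, by rw [← h2, Set.ncard_eq_toFinset_card _ h1]⟩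
    choose! F hF1 hF2 using hF
    -- A triple consists of B, the smaller multiset and m'. The last is 1 or one of s members, which
    -- gives s + 1 choices.
    let T : Finset (Σ _ : ℕ, Σ _ : Multiset ℕ, ℕ) :=
      (n.divisors.erase 1).sigma fun B => (F B).sigma fun M' => insert 1 M'.toFinset
    let Φ : (Σ _ : ℕ, Σ _ : Multiset ℕ, ℕ) → Multiset ℕ := fun x => extend k x.1 x.2.2 x.2.1
    have hT : ∀ x ∈ T, x.1 ∈ n.divisors.erase 1 ∧ IsAdmissible (n / x.1) (k * x.1) x.2.1 ∧
        x.2.1.toFinset.card = s ∧ x.2.2 ∈ insert 1 x.2.1.toFinset := fun x hx => by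
      obtain ⟨h1, h2⟩ := Finset.mem_sigma.mp hx
      obtain ⟨h2, h3⟩ := Finset.mem_sigma.mp h2
      obtain ⟨h4, h5⟩ := (hF1 _ h1 _).mp h2
      exact ⟨h1, h4, h5, h3⟩
    have himg : {M | IsAdmissible n k M ∧ M.toFinset.card = s + 1} = Φ '' (T : Set _) := by
      ext M
      constructor
      · rintro ⟨h1, h2⟩
        have hn1 : 1 < n := by
          by_contra hcon
          have : n = 1 := by omega
          subst this
          rw [isAdmissible_one_iff] at h1
          simp [h1] at h2
        obtain ⟨N, B, m', M', rfl, hB, hM', hm', rfl⟩ := h1.exists_extend hn1 hk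
        have hN : 0 < N := Nat.pos_of_mul_pos_right hn0
        have hBD : B ∈ (N * B).divisors.erase 1 := by
          rw [Finset.mem_erase, Nat.mem_divisors]
          exact ⟨by omega, dvd_mul_left B N, hn0.ne'⟩
        have hdiv : N * B / B = N := Nat.mul_div_cancel _ (by omega)
        refine ⟨⟨B, M', m'⟩, ?_, rfl⟩
        refine Finset.mem_sigma.mpr ⟨hBD, Finset.mem_sigma.mpr ⟨(hF1 B hBD M').mpr ?_, hm'⟩⟩
        rw [hdiv]
        refine ⟨hM', ?_⟩
        rw [hM'.card_toFinset_extend hN hk hB (Nat.coprime_of_squarefree_mul hn) hm'] at h2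
        omega
      · rintro ⟨x, hx, rfl⟩
        obtain ⟨h1, h2, h3, h4⟩ := hT x hx
        obtain ⟨d1, d2, d3, d4, -⟩ := hD _ h1
        have h5 := h2.extend d3 hk d2 d4 h4
        rw [d1] at h5
        exact ⟨h5, by rw [← h3]; exact h2.card_toFinset_extend d3 hk d2 d4 h4⟩
    have hinj : Set.InjOn Φ (T : Set _) := by
      intro x hx y hy hxy
      obtain ⟨h1, h2, h3, h4⟩ := hT x hx
      obtain ⟨d1, d2, d3, d4, -⟩ := hD _ h1
      obtain ⟨h1', h2', h3', h4'⟩ := hT y hy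
      obtain ⟨d1', d2', d3', d4', -⟩ := hD _ h1'
      obtain ⟨e1, e2, e3⟩ := IsAdmissible.extend_injective h2 h2' d3 d3' hk d2 d2' d4 d4' h4 h4'
        (d1.trans d1'.symm) hxy
      obtain ⟨B, M, m⟩ := x
      obtain ⟨B', M', m'⟩ := y
      simp only at e1 e2 e3
      subst e1 e2 e3
      rfl
    rw [himg, hinj.ncard_image, Set.ncard_coe_finset]
    refine ⟨T.finite_toSet.image Φ, ?_⟩
    rw [Finset.card_sigma]
    have hcard : ∀ B ∈ n.divisors.erase 1, ((F B).sigma fun M' => insert 1 M'.toFinset).card =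
        (s + 1) * s.factorial ^ 2 * Nat.stirlingSecond (n / B).primeFactors.card s := by
      intro B hB
      rw [Finset.card_sigma, Finset.sum_congr rfl (g := fun _ => s + 1), Finset.sum_const,
        smul_eq_mul, hF2 B hB]
      · ring
      · intro M' hM'
        obtain ⟨h1, h2⟩ := (hF1 B hB M').mp hM'
        rw [Finset.card_insert_of_notMem, h2]
        rw [Multiset.mem_toFinset]
        exact one_notMem_of_forall h1.1
    rw [Finset.sum_congr rfl hcard, ← Finset.mul_sum, sum_divisors_erase_stirlingSecond hn,
      Nat.factorial_succ]
    ring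

/-- The number of admissible multisets. -/
theorem ncard_isAdmissible {n k : ℕ} (hn : Squarefree n) (hn1 : n ≠ 1) (hk : 0 < k) :
    {M | IsAdmissible n k M}.Finite ∧ {M | IsAdmissible n k M}.ncard =
      ∑ s ∈ Finset.Icc 1 n.primeFactors.card,
        s.factorial ^ 2 * Nat.stirlingSecond n.primeFactors.card s := by
  have hA := fun s => ncard_isAdmissible_card s n k hn hk
  have hU : {M | IsAdmissible n k M} = ⋃ s ∈ Finset.Icc 1 n.primeFactors.card,
      {M | IsAdmissible n k M ∧ M.toFinset.card = s} := by
    ext M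
    simp only [Set.mem_ofPred_eq, Set.mem_iUnion, exists_prop]
    refine ⟨fun h => ⟨M.toFinset.card, ?_, h, rfl⟩, fun ⟨_, _, h, _⟩ => h⟩
    -- Outside this range the Stirling number vanishes; for s = 0 this uses n ≠ 1.
    by_contra hcon
    obtain ⟨h1, h2⟩ := hA M.toFinset.card
    have h3 : Nat.stirlingSecond n.primeFactors.card M.toFinset.card = 0 := by
      rw [Finset.mem_Icc, not_and_or] at hcon
      rcases hcon with h4 | h4
      · have : n.primeFactors.card ≠ 0 := by
          rw [Finset.card_ne_zero, Nat.nonempty_primeFactors]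
          have := hn.ne_zero; omega
        obtain ⟨c, hc⟩ := Nat.exists_eq_succ_of_ne_zero this
        rw [hc, show M.toFinset.card = 0 by omega, Nat.stirlingSecond_succ_zero]
      · exact Nat.stirlingSecond_eq_zero_of_lt (by omega)
    rw [h3, mul_zero, Set.ncard_eq_zero h1] at h2
    exact Set.eq_empty_iff_forall_notMem.mp h2 M ⟨h, rfl⟩
  have hfin : {M | IsAdmissible n k M}.Finite := by
    rw [hU]
    exact Set.Finite.biUnion (Finset.finite_toSet _) fun s _ => (hA s).1
  refine ⟨hfin, ?_⟩
  rw [Set.ncard_eq_toFinset_card _ hfin, Finset.card_eq_sum_card_fiberwise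
    (f := fun M => M.toFinset.card) (t := Finset.Icc 1 n.primeFactors.card)]
  · refine Finset.sum_congr rfl fun s _ => ?_
    rw [← (hA s).2, ← Set.ncard_coe_finset]
    congr 1
    ext M
    simp
  · intro M hM
    have h1 : M ∈ {M | IsAdmissible n k M} := by simpa using hM
    rw [hU] at h1
    simp only [Set.mem_iUnion, exists_prop] at h1
    obtain ⟨s, hs, -, rfl⟩ := h1
    exact hs

/-! ### Barycentric coordinates of lattice points -/

theorem toReal_add {d : ℕ} (x y : Fin d → ℤ) : toReal (x + y) = toReal x + toReal y := by
  funext i; simp [toReal]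

theorem toReal_neg {d : ℕ} (x : Fin d → ℤ) : toReal (-x) = -toReal x := by
  funext i; simp [toReal]

theorem toReal_zero {d : ℕ} : toReal (0 : Fin d → ℤ) = 0 := by
  funext i; simp [toReal]

theorem toReal_zsmul {d : ℕ} (c : ℤ) (x : Fin d → ℤ) : toReal (c • x) = (c : ℝ) • toReal x := by
  funext i; simp [toReal]

theorem toReal_sum {d : ℕ} {ι : Type*} (s : Finset ι) (x : ι → Fin d → ℤ) :
    toReal (∑ i ∈ s, x i) = ∑ i ∈ s, toReal (x i) := by
  funext i; simp [toReal]

theorem toReal_injective {d : ℕ} : Function.Injective (toReal : (Fin d → ℤ) → Fin d → ℝ) :=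
  fun x y h => funext fun i => by
    have := congrFun h i
    simpa [toReal] using this

variable {d : ℕ}

/-- The point with barycentric coordinates `μ`, together with the sum of the coordinates. -/
def homog (v : Fin (d + 1) → Fin d → ℤ) : (Fin (d + 1) → ℝ) →ₗ[ℝ] (Fin d → ℝ) × ℝ where
  toFun μ := (∑ i, μ i • toReal (v i), ∑ i, μ i)
  map_add' μ ν := by simp [add_smul, Finset.sum_add_distrib]
  map_smul' c μ := by simp [mul_smul, Finset.smul_sum, Finset.mul_sum]

theorem homog_apply (v : Fin (d + 1) → Fin d → ℤ) (μ : Fin (d + 1) → ℝ) :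
    homog v μ = (∑ i, μ i • toReal (v i), ∑ i, μ i) := rfl

/-- The vectors of barycentric coordinates of the lattice points, over all heights. -/
def coordLattice (v : Fin (d + 1) → Fin d → ℤ) : AddSubgroup (Fin (d + 1) → ℝ) where
  carrier := {μ | ∃ (z : Fin d → ℤ) (h : ℤ), homog v μ = (toReal z, (h : ℝ))}
  zero_mem' := ⟨0, 0, by simp [toReal_zero]; rfl⟩
  add_mem' := by
    rintro μ ν ⟨z, h, hz⟩ ⟨z', h', hz'⟩
    exact ⟨z + z', h + h', by rw [map_add, hz, hz', toReal_add]; simp⟩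
  neg_mem' := by
    rintro μ ⟨z, h, hz⟩
    exact ⟨-z, -h, by rw [map_neg, hz, toReal_neg]; simp⟩

theorem mem_coordLattice {v : Fin (d + 1) → Fin d → ℤ} {μ : Fin (d + 1) → ℝ} :
    μ ∈ coordLattice v ↔ ∃ (z : Fin d → ℤ) (h : ℤ), homog v μ = (toReal z, (h : ℝ)) := Iff.rfl

theorem intCast_mem_coordLattice (v : Fin (d + 1) → Fin d → ℤ) (z : Fin (d + 1) → ℤ) :
    (fun i => (z i : ℝ)) ∈ coordLattice v :=
  ⟨∑ i, z i • v i, ∑ i, z i, by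
    simp only [homog_apply, toReal_sum, toReal_zsmul, Int.cast_sum]⟩

theorem homog_single (v : Fin (d + 1) → Fin d → ℤ) (i : Fin (d + 1)) :
    homog v (Pi.single i 1) = (toReal (v i), 1) := by
  simp [homog_apply, Pi.single_apply]

theorem homog_injective {v : Fin (d + 1) → Fin d → ℤ}
    (hv : AffineIndependent ℝ fun i => toReal (v i)) : Function.Injective (homog v) := by
  rw [← LinearMap.ker_eq_bot, LinearMap.ker_eq_bot']
  intro μ hμ
  rw [homog_apply, Prod.mk_eq_zero] at hμ
  funext i
  exact affineIndependent_iff.mp hv Finset.univ μ hμ.2 hμ.1 i (Finset.mem_univ i)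

theorem homog_surjective {v : Fin (d + 1) → Fin d → ℤ}
    (hv : AffineIndependent ℝ fun i => toReal (v i)) : Function.Surjective (homog v) :=
  (LinearMap.injective_iff_surjective_of_finrank_eq_finrank (by simp)).mp (homog_injective hv)

theorem mem_convexHull_range_iff {ι E : Type*} [Fintype ι] [AddCommGroup E] [Module ℝ E]
    (p : ι → E) {x : E} : x ∈ convexHull ℝ (Set.range p) ↔
      ∃ μ : ι → ℝ, (∀ i, 0 ≤ μ i) ∧ ∑ i, μ i = 1 ∧ ∑ i, μ i • p i = x := by
  classical
  constructor
  · have h : Set.range p = (Fintype.linearCombination ℝ p) '' Set.range fun i => Pi.single i 1 := by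
      rw [← Set.range_comp]
      congr 1
      funext i
      simp [Fintype.linearCombination_apply, Pi.single_apply]
    rw [h, ← LinearMap.image_convexHull, convexHull_rangle_single_eq_stdSimplex]
    rintro ⟨μ, hμ, rfl⟩
    exact ⟨μ, hμ.1, hμ.2, rfl⟩
  · rintro ⟨μ, h1, h2, h3⟩
    exact mem_convexHull_of_exists_fintype μ p h1 h2 (fun i => Set.mem_range_self i) h3

theorem mem_smul_convexHull_range {v : Fin (d + 1) → Fin d → ℤ} {m : ℝ} (hm : 0 ≤ m)
    {x : Fin d → ℝ} : x ∈ m • convexHull ℝ (Set.range fun i => toReal (v i)) ↔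
      ∃ μ : Fin (d + 1) → ℝ, (∀ i, 0 ≤ μ i) ∧ homog v μ = (x, m) := by
  constructor
  · rintro ⟨y, hy, rfl⟩
    obtain ⟨μ, h1, h2, h3⟩ := (mem_convexHull_range_iff _).mp hy
    refine ⟨m • μ, fun i => mul_nonneg hm (h1 i), ?_⟩
    rw [map_smul, homog_apply, h2, h3]
    simp
  · rintro ⟨μ, h1, h2⟩
    rw [homog_apply, Prod.mk.injEq] at h2
    obtain ⟨h2, h3⟩ := h2
    rcases hm.eq_or_lt with rfl | hm
    · have h4 : ∀ i, μ i = 0 := fun i =>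
        (Finset.sum_eq_zero_iff_of_nonneg fun i _ => h1 i).mp h3 i (Finset.mem_univ i)
      rw [Set.zero_smul_set ((Set.range_nonempty _).convexHull)]
      simp [← h2, h4]
    · refine ⟨m⁻¹ • x, (mem_convexHull_range_iff _).mpr ⟨m⁻¹ • μ,
        fun i => mul_nonneg (inv_nonneg.mpr hm.le) (h1 i), ?_, ?_⟩, smul_inv_smul₀ hm.ne' x⟩
      · simp [← Finset.mul_sum, h3, hm.ne']
      · simp [mul_smul, ← Finset.smul_sum, h2]

/-! ### The box and the h^*-polynomial -/

/-- The lattice elements of the half-open unit cube. -/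
def box (v : Fin (d + 1) → Fin d → ℤ) : Set (Fin (d + 1) → ℝ) :=
  {μ | μ ∈ coordLattice v ∧ ∀ i, 0 ≤ μ i ∧ μ i < 1}

/-- Coordinates in [0, 1) bound the corresponding integral point and height, and `homog` is
injective. -/
theorem finite_box {v : Fin (d + 1) → Fin d → ℤ}
    (hv : AffineIndependent ℝ fun i => toReal (v i)) : (box v).Finite := by
  choose! z h hzh using fun μ (hμ : μ ∈ coordLattice v) => hμ
  let K : Fin d → ℤ := fun c => ∑ i, |v i c|
  have hfin : (Set.Icc (-K) K ×ˢ Set.Icc (0 : ℤ) (d + 1 : ℤ)).Finite :=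
    (Set.finite_Icc _ _).prod (Set.finite_Icc _ _)
  refine Set.Finite.of_finite_image (f := fun μ => (z μ, h μ)) (hfin.subset ?_) ?_
  · rintro _ ⟨μ, ⟨hμ, h01⟩, rfl⟩
    have h1 := hzh μ hμ
    rw [homog_apply, Prod.mk.injEq] at h1
    obtain ⟨h1, h2⟩ := h1
    have h3 : ∀ c, |(z μ c : ℝ)| ≤ (K c : ℝ) := fun c => by
      have h4 := congrFun h1 c
      simp only [Finset.sum_apply, Pi.smul_apply, smul_eq_mul, toReal] at h4
      rw [← h4]
      refine (Finset.abs_sum_le_sum_abs _ _).trans ?_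
      push_cast [K]
      refine Finset.sum_le_sum fun i _ => ?_
      rw [abs_mul, abs_of_nonneg (h01 i).1]
      exact mul_le_of_le_one_left (abs_nonneg _) (h01 i).2.le
    have h5 : (0 : ℝ) ≤ h μ := h2 ▸ Finset.sum_nonneg fun i _ => (h01 i).1
    have h6 : (h μ : ℝ) ≤ (d + 1 : ℤ) := by
      rw [← h2]
      refine (Finset.sum_le_sum fun i _ => (h01 i).2.le).trans ?_
      simp
    refine ⟨⟨fun c => ?_, fun c => ?_⟩, by exact_mod_cast h5, by exact_mod_cast h6⟩
    · have := (abs_le.mp (h3 c)).1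
      exact_mod_cast this
    · have := (abs_le.mp (h3 c)).2
      exact_mod_cast this
  · intro μ hμ ν hν heq
    simp only [Prod.mk.injEq] at heq
    apply homog_injective hv
    rw [hzh μ hμ.1, hzh ν hν.1, heq.1, heq.2]

/-- The height of an element of the box. -/
def boxHeight (μ : Fin (d + 1) → ℝ) : ℕ := ⌊∑ i, μ i⌋₊

theorem boxHeight_eq {v : Fin (d + 1) → Fin d → ℤ} {μ : Fin (d + 1) → ℝ} (hμ : μ ∈ box v) :
    (boxHeight μ : ℝ) = ∑ i, μ i := by
  obtain ⟨⟨z, h, hz⟩, h01⟩ := hμ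
  rw [homog_apply, Prod.mk.injEq] at hz
  have h0 : 0 ≤ ∑ i, μ i := Finset.sum_nonneg fun i _ => (h01 i).1
  rw [hz.2] at h0
  obtain ⟨n, rfl⟩ := Int.eq_ofNat_of_zero_le (show 0 ≤ h by exact_mod_cast h0)
  rw [boxHeight, hz.2]
  simp

/-- The conventional constant term 1 agrees with the count for 0 • P = {0}. -/
theorem ehrhartSeries_eq_mk {v : Fin (d + 1) → Fin d → ℤ} :
    ehrhartSeries (convexHull ℝ (Set.range fun i => toReal (v i))) = PowerSeries.mk fun m =>
      (Set.ncard {x : Fin d → ℤ |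
        toReal x ∈ (m : ℝ) • convexHull ℝ (Set.range fun i => toReal (v i))} : ℤ) := by
  ext m
  rw [ehrhartSeries, PowerSeries.coeff_mk, PowerSeries.coeff_mk]
  split_ifs with h
  · subst h
    rw [Nat.cast_zero, Set.zero_smul_set ((Set.range_nonempty _).convexHull)]
    have : {x : Fin d → ℤ | toReal x ∈ (0 : Set (Fin d → ℝ))} = {0} := by
      ext x
      rw [Set.mem_ofPred_eq, Set.mem_zero, Set.mem_singleton_iff, ← toReal_zero,
        toReal_injective.eq_iff]
    rw [this]
    simp
  · rfl

/-- Splitting coordinates into fractional and integral parts writes each lattice point of mP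
uniquely as a box element plus a vector of natural numbers with sum m minus the box height. -/
theorem ncard_smul_simplex {v : Fin (d + 1) → Fin d → ℤ}
    (hv : AffineIndependent ℝ fun i => toReal (v i)) (m : ℕ) :
    Set.ncard {x : Fin d → ℤ |
        toReal x ∈ (m : ℝ) • convexHull ℝ (Set.range fun i => toReal (v i))} =
      ∑ μ ∈ (finite_box hv).toFinset, if boxHeight μ ≤ m then
        (Finset.finsuppAntidiag (Finset.univ : Finset (Fin (d + 1))) (m - boxHeight μ)).card
      else 0 := by
  classical
  let T : Finset (Σ _ : Fin (d + 1) → ℝ, Fin (d + 1) →₀ ℕ) :=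
    ((finite_box hv).toFinset.filter fun μ => boxHeight μ ≤ m).sigma fun μ =>
      Finset.finsuppAntidiag (Finset.univ : Finset (Fin (d + 1))) (m - boxHeight μ)
  let pt : (Σ _ : Fin (d + 1) → ℝ, Fin (d + 1) →₀ ℕ) → Fin (d + 1) → ℝ :=
    fun x i => x.1 i + (x.2 i : ℝ)
  let F : (Σ _ : Fin (d + 1) → ℝ, Fin (d + 1) →₀ ℕ) → Fin d → ℤ :=
    fun x c => ⌊(homog v (pt x)).1 c⌋
  have hT : ∀ x ∈ T, x.1 ∈ box v ∧ homog v (pt x) = (toReal (F x), (m : ℝ)) := by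
    intro x hx
    obtain ⟨h1, h2⟩ := Finset.mem_sigma.mp hx
    obtain ⟨h1, h3⟩ := Finset.mem_filter.mp h1
    have h1 : x.1 ∈ box v := (finite_box hv).mem_toFinset.mp h1
    rw [Finset.mem_finsuppAntidiag] at h2
    refine ⟨h1, ?_⟩
    have h4 : pt x ∈ coordLattice v :=
      add_mem h1.1 (intCast_mem_coordLattice v fun i => (x.2 i : ℤ))
    obtain ⟨z, h, hz⟩ := h4
    have h5 : F x = z := by
      funext c
      simp only [F, hz, toReal, Int.floor_intCast]
    rw [h5]
    refine Prod.ext (by rw [hz]) ?_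
    rw [homog_apply]
    simp only [pt, Finset.sum_add_distrib]
    rw [← boxHeight_eq h1]
    have h6 : ∑ i, x.2 i = m - boxHeight x.1 := h2.1
    rw [← Nat.cast_sum, h6]
    exact_mod_cast Nat.add_sub_of_le h3
  have himg : {x : Fin d → ℤ |
      toReal x ∈ (m : ℝ) • convexHull ℝ (Set.range fun i => toReal (v i))} = F '' (T : Set _) := by
    ext z
    rw [Set.mem_ofPred_eq, mem_smul_convexHull_range (Nat.cast_nonneg m)]
    constructor
    · rintro ⟨ν, hν, hz⟩
      let a : Fin (d + 1) →₀ ℕ := Finsupp.equivFunOnFinite.symm fun i => ⌊ν i⌋₊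
      have ha : ∀ i, (a i : ℝ) = ⌊ν i⌋ := fun i => by
        simp only [a, Finsupp.equivFunOnFinite_symm_apply_apply]
        rw [natCast_floor_eq_intCast_floor (hν i)]
      let μ : Fin (d + 1) → ℝ := fun i => Int.fract (ν i)
      have hpt : pt ⟨μ, a⟩ = ν := by
        funext i
        simp only [pt, μ, ha]
        exact Int.fract_add_floor (ν i)
      have hμ : μ ∈ box v := by
        refine ⟨?_, fun i => ⟨Int.fract_nonneg _, Int.fract_lt_one _⟩⟩
        have h1 : μ = ν - fun i => ((⌊ν i⌋ : ℤ) : ℝ) := by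
          funext i
          rfl
        rw [h1]
        exact sub_mem ⟨z, m, by rw [hz]; simp⟩ (intCast_mem_coordLattice v _)
      have hsum : (boxHeight μ : ℝ) + ((∑ i, a i : ℕ) : ℝ) = m := by
        rw [boxHeight_eq hμ, Nat.cast_sum, ← Finset.sum_add_distrib]
        have h2 := congrArg Prod.snd hz
        rw [homog_apply] at h2
        exact (Finset.sum_congr rfl fun i _ => congrFun hpt i).trans h2
      have hsum' : boxHeight μ + ∑ i, a i = m := by exact_mod_cast hsum
      refine ⟨⟨μ, a⟩, ?_, ?_⟩
      · refine Finset.mem_sigma.mpr ⟨Finset.mem_filter.mpr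
          ⟨(finite_box hv).mem_toFinset.mpr hμ, by simp only; omega⟩, ?_⟩
        rw [Finset.mem_finsuppAntidiag]
        refine ⟨?_, Finset.subset_univ _⟩
        change ∑ i, a i = m - boxHeight μ
        omega
      · funext c
        simp only [F, hpt, hz, toReal, Int.floor_intCast]
    · rintro ⟨x, hx, rfl⟩
      obtain ⟨h1, h2⟩ := hT x hx
      exact ⟨pt x, fun i => add_nonneg (h1.2 i).1 (Nat.cast_nonneg _), h2⟩
  have hinj : Set.InjOn F (T : Set _) := by
    rintro ⟨μ, a⟩ hx ⟨ν, b⟩ hy hxy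
    obtain ⟨h1, h2⟩ := hT _ hx
    obtain ⟨h1', h2'⟩ := hT _ hy
    rw [hxy, ← h2'] at h2
    have h3 := homog_injective hv h2
    have h4 : ∀ i, μ i + (a i : ℝ) = ν i + (b i : ℝ) := fun i => congrFun h3 i
    have h5 : a = b := by
      ext i
      have e1 := h1.2 i
      have e2 := h1'.2 i
      have e3 := h4 i
      simp only at e1 e2
      have e4 : (a i : ℝ) < b i + 1 := by linarith
      have e5 : (b i : ℝ) < a i + 1 := by linarith
      have e6 : a i < b i + 1 := by exact_mod_cast e4
      have e7 : b i < a i + 1 := by exact_mod_cast e5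
      omega
    subst h5
    have h6 : μ = ν := funext fun i => by
      have := h4 i
      linarith
    subst h6
    rfl
  rw [himg, hinj.ncard_image, Set.ncard_coe_finset, Finset.card_sigma, Finset.sum_filter]

/-- Ehrhart series of a lattice simplex: the `h^*`-polynomial is given by the heights of the
elements of the box. -/
theorem ehrhartSeries_mul {v : Fin (d + 1) → Fin d → ℤ}
    (hv : AffineIndependent ℝ fun i => toReal (v i)) :
    ehrhartSeries (convexHull ℝ (Set.range fun i => toReal (v i))) *
        (1 - PowerSeries.X) ^ (d + 1) =
      ((∑ μ ∈ (finite_box hv).toFinset, Polynomial.X ^ boxHeight μ : Polynomial ℤ) :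
        PowerSeries ℤ) := by
  have h1 : ehrhartSeries (convexHull ℝ (Set.range fun i => toReal (v i))) =
      ((∑ μ ∈ (finite_box hv).toFinset, Polynomial.X ^ boxHeight μ : Polynomial ℤ) :
        PowerSeries ℤ) * (PowerSeries.mk 1) ^ (d + 1) := by
    ext m
    rw [ehrhartSeries_eq_mk, PowerSeries.coeff_mk, ncard_smul_simplex hv]
    have h2 : ((∑ μ ∈ (finite_box hv).toFinset, Polynomial.X ^ boxHeight μ : Polynomial ℤ) :
        PowerSeries ℤ) = ∑ μ ∈ (finite_box hv).toFinset, PowerSeries.X ^ boxHeight μ := by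
      rw [← Polynomial.coeToPowerSeries.ringHom_apply, map_sum]
      simp
    -- As a product, this power of the geometric series counts vectors of d + 1 natural numbers by
    -- their sum.
    have h3 : (PowerSeries.mk 1 : PowerSeries ℤ) ^ (d + 1) =
        ∏ _i : Fin (d + 1), PowerSeries.mk 1 := by simp
    rw [h2, Finset.sum_mul, map_sum]
    push_cast
    refine Finset.sum_congr rfl fun μ _ => ?_
    rw [PowerSeries.coeff_X_pow_mul', h3, PowerSeries.coeff_prod]
    simp
  rw [h1, mul_assoc, ← mul_pow, PowerSeries.mk_one_mul_one_sub_eq_one, one_pow, mul_one]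

theorem hasHStarPolynomial_iff {v : Fin (d + 1) → Fin d → ℤ}
    (hv : AffineIndependent ℝ fun i => toReal (v i)) (h : Polynomial ℤ) :
    HasHStarPolynomial (convexHull ℝ (Set.range fun i => toReal (v i))) h ↔
      ∑ μ ∈ (finite_box hv).toFinset, Polynomial.X ^ boxHeight μ = h := by
  rw [HasHStarPolynomial, ehrhartSeries_mul hv, Polynomial.coe_inj]

/-- The exponents i * k are distinct as k > 0, so n box elements attaining all n of them attain each
exactly once. -/
theorem hasHStarPolynomial_typePolynomial_iff {v : Fin (d + 1) → Fin d → ℤ}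
    (hv : AffineIndependent ℝ fun i => toReal (v i)) {n k : ℕ} (hk : 0 < k) :
    HasHStarPolynomial (convexHull ℝ (Set.range fun i => toReal (v i))) (typePolynomial n k) ↔
      (box v).ncard = n ∧ ∀ i < n, ∃ μ ∈ box v, ∑ j, μ j = (i * k : ℕ) := by
  rw [hasHStarPolynomial_iff hv, typePolynomial, Set.ncard_eq_toFinset_card _ (finite_box hv)]
  constructor
  · intro h
    constructor
    · have := congrArg (Polynomial.eval 1) h
      simp only [Polynomial.eval_finsetSum, Polynomial.eval_pow, Polynomial.eval_X, one_pow,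
        Finset.sum_const, Finset.card_range] at this
      simpa using this
    · intro i hi
      by_contra hcon
      push Not at hcon
      have := congrArg (fun p => Polynomial.coeff p (i * k)) h
      simp only [Polynomial.finsetSum_coeff, Polynomial.coeff_X_pow] at this
      rw [Finset.sum_eq_zero, Finset.sum_eq_single i] at this
      · simp at this
      · intro j _ hj
        rw [if_neg]
        exact fun h => hj (Nat.eq_of_mul_eq_mul_right hk h).symm
      · intro h
        exact absurd (Finset.mem_range.mpr hi) h
      · intro μ hμ
        have hμ := (finite_box hv).mem_toFinset.mp hμ
        rw [if_neg]
        intro h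
        refine hcon μ hμ ?_
        rw [← boxHeight_eq hμ, ← h]
  · rintro ⟨h1, h2⟩
    choose! g hg1 hg2 using h2
    have hg3 : ∀ i < n, boxHeight (g i) = i * k := fun i hi => by
      have := boxHeight_eq (hg1 i hi)
      rw [hg2 i hi] at this
      exact_mod_cast this
    have hginj : Set.InjOn g (Finset.range n : Set ℕ) := by
      intro i hi j hj hij
      have hi := Finset.mem_range.mp hi
      have hj := Finset.mem_range.mp hj
      have h3 := hg3 i hi
      rw [hij, hg3 j hj] at h3
      exact (Nat.eq_of_mul_eq_mul_right hk h3).symm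
    have himg : (Finset.range n).image g = (finite_box hv).toFinset := by
      refine Finset.eq_of_subset_of_card_le ?_ ?_
      · intro μ hμ
        obtain ⟨i, hi, rfl⟩ := Finset.mem_image.mp hμ
        exact (finite_box hv).mem_toFinset.mpr (hg1 i (Finset.mem_range.mp hi))
      · rw [Finset.card_image_of_injOn hginj, h1, Finset.card_range]
    rw [← himg, Finset.sum_image hginj]
    exact Finset.sum_congr rfl fun i hi => by rw [hg3 i (Finset.mem_range.mp hi)]

theorem affineIndependent_of_homog {v : Fin (d + 1) → Fin d → ℤ}
    (h : ∀ μ, homog v μ = 0 → μ = 0) : AffineIndependent ℝ fun i => toReal (v i) := by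
  rw [affineIndependent_iff]
  intro s w hw hv i hi
  classical
  have h1 := h (fun i => if i ∈ s then w i else 0) (by
    rw [homog_apply, Prod.mk_eq_zero]
    simp only [ite_smul, zero_smul, Finset.sum_ite_mem, Finset.univ_inter]
    exact ⟨hv, hw⟩)
  have := congrFun h1 i
  simpa [hi] using this

theorem affineIndependent_iff_homog {v : Fin (d + 1) → Fin d → ℤ} :
    AffineIndependent ℝ (fun i => toReal (v i)) ↔ ∀ μ, homog v μ = 0 → μ = 0 :=
  ⟨fun h _ hμ => homog_injective h (hμ.trans (map_zero _).symm), affineIndependent_of_homog⟩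

/-- The lattice generated by the integral vectors and the vector of the numbers `1 / m i`. -/
def refLattice {ι : Type*} (m : ι → ℕ) : AddSubgroup (ι → ℝ) where
  carrier := {μ | ∃ (z : ι → ℤ) (t : ℤ), ∀ i, μ i = z i + t / m i}
  zero_mem' := ⟨0, 0, by simp⟩
  add_mem' := by
    rintro μ ν ⟨z, t, h⟩ ⟨z', t', h'⟩
    refine ⟨z + z', t + t', fun i => ?_⟩
    rw [Pi.add_apply, h, h']
    push_cast [Pi.add_apply]
    ring
  neg_mem' := by
    rintro μ ⟨z, t, h⟩
    refine ⟨-z, -t, fun i => ?_⟩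
    rw [Pi.neg_apply, h]
    push_cast [Pi.neg_apply]
    ring

theorem inv_mem_refLattice {ι : Type*} (m : ι → ℕ) : (fun i => (1 : ℝ) / m i) ∈ refLattice m :=
  ⟨0, 1, by simp⟩

/-- Clearing denominators in 1 / m i = z i + t / m' i exhibits m' i as a multiple of m i. -/
theorem dvd_of_refLattice_le {ι : Type*} {m m' : ι → ℕ} (hm : ∀ i, 0 < m i) (hm' : ∀ i, 0 < m' i)
    (h : refLattice m ≤ refLattice m') (i : ι) : m i ∣ m' i := by
  obtain ⟨z, t, hz⟩ := h (inv_mem_refLattice m)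
  have h1 := hz i
  have h2 : (m i : ℝ) ≠ 0 := by have := hm i; positivity
  have h3 : (m' i : ℝ) ≠ 0 := by have := hm' i; positivity
  field_simp at h1
  have h4 : (m' i : ℤ) = m i * (z i * m' i + t) := by exact_mod_cast h1
  exact_mod_cast Dvd.intro _ h4.symm

theorem refLattice_injective {ι : Type*} {m m' : ι → ℕ} (hm : ∀ i, 0 < m i) (hm' : ∀ i, 0 < m' i)
    (h : refLattice m = refLattice m') : m = m' :=
  funext fun i => Nat.dvd_antisymm (dvd_of_refLattice_le hm hm' h.le i)
    (dvd_of_refLattice_le hm' hm h.ge i)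

/-! ### Unimodular equivalence in terms of coordinate lattices -/

section Equivalence

/-- Passing from `homog v` to `homog v'` is linear and preserves the height. Inclusion of the
lattices says that it maps integral points to integral points. -/
theorem exists_affine_of_coordLattice_le {v v' : Fin (d + 1) → Fin d → ℤ}
    (hv : AffineIndependent ℝ fun i => toReal (v i)) (h : coordLattice v ≤ coordLattice v') :
    ∃ (U : Matrix (Fin d) (Fin d) ℤ) (w : Fin d → ℤ), ∀ μ, homog v' μ =
      (Matrix.vecMul (homog v μ).1 (U.map (Int.cast : ℤ → ℝ)) + (homog v μ).2 • toReal w,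
        (homog v μ).2) := by
  have key : ∀ (x : Fin d → ℤ) (c : ℤ), ∃ (μ : Fin (d + 1) → ℝ) (y : Fin d → ℤ),
      homog v μ = (toReal x, (c : ℝ)) ∧ homog v' μ = (toReal y, (c : ℝ)) := by
    intro x c
    obtain ⟨μ, hμ⟩ := homog_surjective hv (toReal x, (c : ℝ))
    obtain ⟨y, c', hy⟩ := h (show μ ∈ coordLattice v from ⟨x, c, hμ⟩)
    refine ⟨μ, y, hμ, ?_⟩
    rw [hy]
    have h1 := congrArg Prod.snd hμ
    have h2 := congrArg Prod.snd hy
    simp only [homog_apply] at h1 h2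
    rw [← h1, ← h2]
  -- The image of the origin at height 1 is w; the images of the unit vectors at height 0 are the
  -- rows of U.
  obtain ⟨μ₀, w, h0, h0'⟩ := key 0 1
  choose μ u hμ hu using fun i : Fin d => key (Pi.single i 1) 0
  refine ⟨Matrix.of u, w, fun ν => ?_⟩
  set x := (homog v ν).1 with hx
  set c := (homog v ν).2 with hc
  have hν : ν = ∑ i, x i • μ i + c • μ₀ := by
    apply homog_injective hv
    rw [map_add, map_sum, map_smul, h0]
    simp only [map_smul, hμ]
    refine Prod.ext ?_ ?_
    · rw [← hx]
      funext j
      simp [Prod.fst_sum, toReal, Pi.single_apply]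
    · rw [← hc]
      simp [Prod.snd_sum]
  conv_lhs => rw [hν]
  rw [map_add, map_sum, map_smul, h0']
  simp only [map_smul, hu]
  refine Prod.ext ?_ ?_
  · funext j
    simp [Prod.fst_sum, toReal, Matrix.vecMul, dotProduct]
  · simp [Prod.snd_sum]

theorem convexHull_eq_affineMap_image {v v' : Fin (d + 1) → Fin d → ℤ}
    {U : Matrix (Fin d) (Fin d) ℤ} {w : Fin d → ℤ}
    (h : ∀ μ, homog v' μ =
      (Matrix.vecMul (homog v μ).1 (U.map (Int.cast : ℤ → ℝ)) + (homog v μ).2 • toReal w,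
        (homog v μ).2)) :
    convexHull ℝ (Set.range fun i => toReal (v' i)) =
      affineMap U w '' convexHull ℝ (Set.range fun i => toReal (v i)) := by
  have hmem : ∀ (v : Fin (d + 1) → Fin d → ℤ) (x : Fin d → ℝ),
      x ∈ convexHull ℝ (Set.range fun i => toReal (v i)) ↔
        ∃ μ : Fin (d + 1) → ℝ, (∀ i, 0 ≤ μ i) ∧ homog v μ = (x, 1) := fun v x => by
    rw [← mem_smul_convexHull_range zero_le_one, one_smul]
  ext x
  rw [hmem, Set.mem_image]
  constructor
  · rintro ⟨μ, h1, h2⟩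
    rw [h, Prod.mk.injEq] at h2
    refine ⟨(homog v μ).1, (hmem v _).mpr ⟨μ, h1, Prod.ext rfl h2.2⟩, ?_⟩
    rw [← h2.1, h2.2, one_smul, affineMap]
  · rintro ⟨y, hy, rfl⟩
    obtain ⟨μ, h1, h2⟩ := (hmem v y).mp hy
    refine ⟨μ, h1, ?_⟩
    rw [h, h2, one_smul, affineMap]

/-- Lattice simplices with the same lattice of barycentric coordinates are equivalent. -/
theorem unimodularEquiv_of_coordLattice_eq {v v' : Fin (d + 1) → Fin d → ℤ}
    (hv : AffineIndependent ℝ fun i => toReal (v i))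
    (hv' : AffineIndependent ℝ fun i => toReal (v' i)) (h : coordLattice v = coordLattice v') :
    UnimodularEquiv (convexHull ℝ (Set.range fun i => toReal (v i)))
      (convexHull ℝ (Set.range fun i => toReal (v' i))) := by
  obtain ⟨U, w, hU⟩ := exists_affine_of_coordLattice_le hv h.le
  obtain ⟨U', w', hU'⟩ := exists_affine_of_coordLattice_le hv' h.ge
  refine ⟨U, w, ?_, convexHull_eq_affineMap_image hU⟩
  -- On vectors of height 0 the translations drop out, so the two integral maps are mutually inverse
  -- and the determinant is a unit.
  have h1 : U * U' = 1 := by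
    have h2 : ∀ x : Fin d → ℝ, Matrix.vecMul x ((U * U').map (Int.cast : ℤ → ℝ)) = x := by
      intro x
      obtain ⟨μ, hμ⟩ := homog_surjective hv (x, 0)
      have h3 := hU μ
      have h4 := hU' μ
      rw [hμ] at h3
      rw [h3, hμ] at h4
      have h5 := congrArg Prod.fst h4
      simp only [zero_smul, add_zero] at h5
      have h6 : (U * U').map (Int.cast : ℤ → ℝ)
          = U.map (Int.cast : ℤ → ℝ) * U'.map (Int.cast : ℤ → ℝ) :=
        Matrix.map_mul (f := Int.castRingHom ℝ)
      rw [h6, ← Matrix.vecMul_vecMul, ← h5]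
    ext i j
    have h3 := congrFun (h2 (Pi.single i 1)) j
    rw [Matrix.single_one_vecMul] at h3
    simp only [Matrix.row, Matrix.map_apply] at h3
    rw [Matrix.one_apply]
    have h4 : ((U * U') i j : ℝ) = ((if i = j then 1 else 0 : ℤ) : ℝ) := by
      rw [h3]
      simp [Pi.single_apply, eq_comm]
    exact_mod_cast h4
  have h2 := congrArg Matrix.det h1
  rw [Matrix.det_mul, Matrix.det_one] at h2
  exact Int.isUnit_iff.mp (IsUnit.of_mul_eq_one _ h2)

theorem homog_affine {v : Fin (d + 1) → Fin d → ℤ} (U : Matrix (Fin d) (Fin d) ℤ) (w : Fin d → ℤ)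
    (μ : Fin (d + 1) → ℝ) : homog (fun i => Matrix.vecMul (v i) U + w) μ =
      (Matrix.vecMul (homog v μ).1 (U.map (Int.cast : ℤ → ℝ)) + (homog v μ).2 • toReal w,
        (homog v μ).2) := by
  refine Prod.ext ?_ rfl
  simp only [homog_apply, Matrix.sum_vecMul, Matrix.smul_vecMul, toReal_add, smul_add,
    Finset.sum_add_distrib, Finset.sum_smul]
  congr 1
  refine Finset.sum_congr rfl fun i _ => ?_
  congr 1
  funext j
  simp [toReal, Matrix.vecMul, dotProduct]

theorem coordLattice_le_affine {v : Fin (d + 1) → Fin d → ℤ} (U : Matrix (Fin d) (Fin d) ℤ)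
    (w : Fin d → ℤ) : coordLattice v ≤ coordLattice fun i => Matrix.vecMul (v i) U + w := by
  rintro μ ⟨z, h, hz⟩
  refine ⟨Matrix.vecMul z U + h • w, h, ?_⟩
  rw [homog_affine, hz, toReal_add, toReal_zsmul]
  refine Prod.ext ?_ rfl
  simp only
  congr 1
  funext j
  simp [toReal, Matrix.vecMul, dotProduct]

theorem affine_inv {U : Matrix (Fin d) (Fin d) ℤ} (hU : U.det = 1 ∨ U.det = -1)
    (w x : Fin d → ℤ) :
    Matrix.vecMul (Matrix.vecMul x U + w) U⁻¹ + -Matrix.vecMul w U⁻¹ = x := by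
  have hu : IsUnit U.det := Int.isUnit_iff.mpr hU
  rw [Matrix.add_vecMul, Matrix.vecMul_vecMul, Matrix.mul_nonsing_inv U hu, Matrix.vecMul_one,
    add_neg_cancel_right]

theorem coordLattice_affine (v : Fin (d + 1) → Fin d → ℤ) {U : Matrix (Fin d) (Fin d) ℤ}
    (hU : U.det = 1 ∨ U.det = -1) (w : Fin d → ℤ) :
    coordLattice (fun i => Matrix.vecMul (v i) U + w) = coordLattice v := by
  refine le_antisymm ?_ (coordLattice_le_affine U w)
  have h1 := coordLattice_le_affine (v := fun i => Matrix.vecMul (v i) U + w) U⁻¹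
    (-Matrix.vecMul w U⁻¹)
  simpa only [affine_inv hU] using h1

theorem affineIndependent_affine {v : Fin (d + 1) → Fin d → ℤ}
    (hv : AffineIndependent ℝ fun i => toReal (v i)) {U : Matrix (Fin d) (Fin d) ℤ}
    (hU : U.det = 1 ∨ U.det = -1) (w : Fin d → ℤ) :
    AffineIndependent ℝ fun i => toReal (Matrix.vecMul (v i) U + w) := by
  rw [affineIndependent_iff_homog] at hv ⊢
  intro μ hμ
  apply hv
  have h1 := homog_affine (v := fun i => Matrix.vecMul (v i) U + w) U⁻¹
    (-Matrix.vecMul w U⁻¹) μ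
  simp only [affine_inv hU] at h1
  rw [h1, hμ]
  simp

/-- A vertex is extreme: expanding it in the v' j, and these in the v i, writes a coordinate unit
vector as a convex combination of nonnegative vectors of sum 1. Any one with positive weight must be
that unit vector. -/
theorem exists_perm_of_convexHull_eq {v v' : Fin (d + 1) → Fin d → ℤ}
    (hv : AffineIndependent ℝ fun i => toReal (v i))
    (h : convexHull ℝ (Set.range fun i => toReal (v i)) =
      convexHull ℝ (Set.range fun i => toReal (v' i))) :
    ∃ σ : Equiv.Perm (Fin (d + 1)), ∀ i, v i = v' (σ i) := by
  have key : ∀ i, ∃ j, v i = v' j := by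
    intro i
    have h1 : toReal (v i) ∈ convexHull ℝ (Set.range fun i => toReal (v' i)) :=
      h ▸ subset_convexHull ℝ _ (Set.mem_range_self i)
    obtain ⟨β, hβ0, hβ1, hβ⟩ := (mem_convexHull_range_iff _).mp h1
    have h2 : ∀ j, ∃ α : Fin (d + 1) → ℝ, (∀ l, 0 ≤ α l) ∧ homog v α = (toReal (v' j), 1) := by
      intro j
      rw [← mem_smul_convexHull_range zero_le_one, one_smul, h]
      exact subset_convexHull ℝ _ (Set.mem_range_self j)
    choose α hα0 hα using h2
    have h3 : ∑ j, β j • α j = Pi.single i 1 := by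
      apply homog_injective hv
      rw [map_sum, homog_single]
      simp only [map_smul, hα]
      refine Prod.ext ?_ ?_
      · simpa [Prod.fst_sum] using hβ
      · simpa [Prod.snd_sum] using hβ1
    obtain ⟨j, hj⟩ : ∃ j, 0 < β j := by
      by_contra hcon
      push Not at hcon
      have : ∑ j, β j ≤ 0 := Finset.sum_nonpos fun j _ => hcon j
      linarith
    refine ⟨j, toReal_injective ?_⟩
    have h4 : ∀ l, l ≠ i → α j l = 0 := fun l hl => by
      have h5 := congrFun h3 l
      rw [Pi.single_eq_of_ne hl, Finset.sum_apply] at h5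
      have h6 := (Finset.sum_eq_zero_iff_of_nonneg fun j _ => by
        exact mul_nonneg (hβ0 j) (hα0 j l)).mp h5 j (Finset.mem_univ j)
      exact (mul_eq_zero.mp h6).resolve_left hj.ne'
    have h5 : α j i = 1 := by
      have := congrArg Prod.snd (hα j)
      rw [homog_apply] at this
      simp only at this
      rwa [Finset.sum_eq_single i (fun l _ hl => h4 l hl) (by simp)] at this
    have h6 : α j = Pi.single i 1 := by
      funext l
      by_cases hl : l = i
      · subst hl; simp [h5]
      · rw [h4 l hl, Pi.single_eq_of_ne hl]
    have h7 := hα j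
    rw [h6, homog_single] at h7
    exact congrArg Prod.fst h7
  choose σ hσ using key
  have hinj : Function.Injective σ := fun i j hij => hv.injective (by
    simp only [hσ i, hσ j, hij])
  exact ⟨Equiv.ofBijective σ (Finite.injective_iff_bijective.mp hinj), hσ⟩

theorem mem_coordLattice_comp_perm {v : Fin (d + 1) → Fin d → ℤ} (σ : Equiv.Perm (Fin (d + 1)))
    (μ : Fin (d + 1) → ℝ) : μ ∘ σ ∈ coordLattice (v ∘ σ) ↔ μ ∈ coordLattice v := by
  rw [mem_coordLattice, mem_coordLattice, homog_apply, homog_apply]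
  have h1 : ∑ i, (μ ∘ σ) i • toReal ((v ∘ σ) i) = ∑ i, μ i • toReal (v i) :=
    Equiv.sum_comp σ fun i => μ i • toReal (v i)
  have h2 : ∑ i, (μ ∘ σ) i = ∑ i, μ i := Equiv.sum_comp σ μ
  rw [h1, h2]

theorem mem_refLattice_comp_perm {ι : Type*} {m : ι → ℕ} (σ : Equiv.Perm ι)
    (μ : ι → ℝ) : μ ∘ σ ∈ refLattice (m ∘ σ) ↔ μ ∈ refLattice m := by
  constructor
  · rintro ⟨z, t, h⟩
    refine ⟨z ∘ σ.symm, t, fun i => ?_⟩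
    simpa using h (σ.symm i)
  · rintro ⟨z, t, h⟩
    exact ⟨z ∘ σ, t, fun i => h (σ i)⟩

/-- The denominators are an invariant of the equivalence class. -/
theorem exists_perm_of_unimodularEquiv {v v' : Fin (d + 1) → Fin d → ℤ} {m m' : Fin (d + 1) → ℕ}
    (hv' : AffineIndependent ℝ fun i => toReal (v' i)) (hm : ∀ i, 0 < m i) (hm' : ∀ i, 0 < m' i)
    (hvm : coordLattice v = refLattice m) (hvm' : coordLattice v' = refLattice m')
    (h : UnimodularEquiv (convexHull ℝ (Set.range fun i => toReal (v i)))
      (convexHull ℝ (Set.range fun i => toReal (v' i)))) :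
    ∃ σ : Equiv.Perm (Fin (d + 1)), m' = m ∘ σ := by
  obtain ⟨U, w, hU, hP⟩ := h
  rw [← convexHull_eq_affineMap_image (homog_affine U w)] at hP
  obtain ⟨σ, hσ⟩ := exists_perm_of_convexHull_eq hv' hP
  refine ⟨σ, refLattice_injective hm' (fun i => hm (σ i)) ?_⟩
  rw [← hvm']
  ext μ
  obtain ⟨ν, rfl⟩ : ∃ ν, μ = ν ∘ σ := ⟨μ ∘ σ.symm, by funext i; simp⟩
  have h1 : v' = (fun i => Matrix.vecMul (v i) U + w) ∘ σ := funext hσ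
  rw [h1, mem_coordLattice_comp_perm, coordLattice_affine v hU, hvm, mem_refLattice_comp_perm]

end Equivalence

/-! ### Realizing prescribed denominators -/

section Existence

/-- The integral multiples by `N` of the elements with coordinate sum zero in the lattice generated
by the integral vectors and `q / N`. -/
def scaledKernel (N : ℤ) (q : Fin (d + 1) → ℤ) : Submodule ℤ (Fin (d + 1) → ℤ) where
  carrier := {x | ∑ i, x i = 0 ∧ ∃ (z : Fin (d + 1) → ℤ) (t : ℤ), ∀ i, x i = N * z i + t * q i}
  zero_mem' := ⟨by simp, 0, 0, by simp⟩
  add_mem' := by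
    rintro x y ⟨hx, z, t, h⟩ ⟨hy, z', t', h'⟩
    refine ⟨by simp [Finset.sum_add_distrib, hx, hy], z + z', t + t', fun i => ?_⟩
    simp only [Pi.add_apply, h, h']
    ring
  smul_mem' := by
    rintro c x ⟨hx, z, t, h⟩
    refine ⟨by simp [← Finset.mul_sum, hx], c • z, c * t, fun i => ?_⟩
    simp only [Pi.smul_apply, smul_eq_mul, h]
    ring

/-- Forgetting the coordinate 0, which the zero sum determines, gives the upper bound. The lower
bound comes from N times all integral vectors of sum zero. -/
theorem finrank_scaledKernel {N : ℤ} (hN : N ≠ 0) (q : Fin (d + 1) → ℤ) :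
    Module.finrank ℤ (scaledKernel N q) = d := by
  apply le_antisymm
  · let f : scaledKernel N q →ₗ[ℤ] (Fin d → ℤ) :=
      (LinearMap.funLeft ℤ ℤ Fin.succ).comp (scaledKernel N q).subtype
    have hf : Function.Injective f := by
      intro x y hxy
      have h1 : ∀ i : Fin d, x.1 i.succ = y.1 i.succ := fun i => congrFun hxy i
      apply Subtype.ext
      funext i
      refine Fin.cases ?_ h1 i
      have hx := x.2.1
      have hy := y.2.1
      rw [Fin.sum_univ_succ] at hx hy
      simp only [h1] at hx
      linarith
    simpa using LinearMap.finrank_le_finrank_of_injective hf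
  · let f : (Fin d → ℤ) →ₗ[ℤ] scaledKernel N q :=
      { toFun := fun y => ⟨N • Fin.cons (-∑ i, y i) y, by simp [Fin.sum_univ_succ, ← Finset.mul_sum],
          Fin.cons (-∑ i, y i) y, 0, by simp⟩
        map_add' := fun x y => by
          apply Subtype.ext
          funext i
          refine Fin.cases ?_ (fun j => ?_) i
          · simp [Finset.sum_add_distrib]; ring
          · simp; ring
        map_smul' := fun c x => by
          apply Subtype.ext
          funext i
          refine Fin.cases ?_ (fun j => ?_) i
          · simp [← Finset.mul_sum]; ring
          · simp; ring }
    have hf : Function.Injective f := by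
      intro x y hxy
      funext i
      have h1 := congrFun (congrArg Subtype.val hxy) i.succ
      simpa [f, hN] using h1
    simpa using LinearMap.finrank_le_finrank_of_injective hf

/-- Every sequence of positive integers whose inverses have an integral sum comes from a lattice
simplex. -/
theorem exists_simplex_of_denominators (m : Fin (d + 1) → ℕ) (hm : ∀ i, 0 < m i) {r : ℤ}
    (hr : ∑ i, (1 : ℝ) / m i = r) : ∃ v : Fin (d + 1) → Fin d → ℤ,
      AffineIndependent ℝ (fun i => toReal (v i)) ∧ coordLattice v = refLattice m := by
  obtain ⟨N, hN, q, hq⟩ : ∃ N : ℤ, N ≠ 0 ∧ ∃ q : Fin (d + 1) → ℤ, ∀ i, N = q i * m i := by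
    refine ⟨∏ i, (m i : ℤ), Finset.prod_ne_zero_iff.mpr fun i _ => by have := hm i; positivity,
      fun i => ∏ j ∈ Finset.univ.erase i, (m j : ℤ), fun i => ?_⟩
    exact (Finset.prod_erase_mul _ _ (Finset.mem_univ i)).symm
  have hNr : (N : ℝ) ≠ 0 := by exact_mod_cast hN
  have hqr : ∀ i, (q i : ℝ) / N = 1 / m i := fun i => by
    have h1 : (m i : ℝ) ≠ 0 := by have := hm i; positivity
    have h2 : (N : ℝ) = q i * m i := by exact_mod_cast hq i
    field_simp
    linarith
  -- A basis of the height-zero part identifies it with ℤ^d. The vertices are the classes of e_i -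
  -- e_0 in this basis, everything being scaled by N to stay integral.
  let b : Module.Basis (Fin d) ℤ (scaledKernel N q) :=
    Module.finBasisOfFinrankEq ℤ _ (finrank_scaledKernel hN q)
  let B : (Fin d → ℝ) →ₗ[ℝ] (Fin (d + 1) → ℝ) :=
    Fintype.linearCombination ℝ fun j => toReal (b j : Fin (d + 1) → ℤ)
  have hB : ∀ y : Fin d → ℤ, B (toReal y) =
      toReal ((∑ j, y j • b j : scaledKernel N q) : Fin (d + 1) → ℤ) := fun y => by
    rw [AddSubmonoidClass.coe_finsetSum, toReal_sum]
    simp [B, Fintype.linearCombination_apply, toReal, ← toReal_zsmul]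
  have hBrepr : ∀ x : scaledKernel N q, B (toReal (b.repr x)) = toReal (x : Fin (d + 1) → ℤ) :=
    fun x => by rw [hB, b.sum_repr]
  let e : Fin (d + 1) → scaledKernel N q := fun i =>
    ⟨N • (Pi.single i 1 - Pi.single 0 1), by simp [← Finset.mul_sum],
      Pi.single i 1 - Pi.single 0 1, 0, by simp⟩
  let v : Fin (d + 1) → Fin d → ℤ := fun i => b.repr (e i)
  have hBv : ∀ μ : Fin (d + 1) → ℝ, B (homog v μ).1 =
      (N : ℝ) • (μ - (homog v μ).2 • Pi.single 0 1) := by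
    intro μ
    rw [homog_apply]
    simp only [map_sum, map_smul]
    have h1 : ∀ i, B (toReal (v i)) = (N : ℝ) • (Pi.single i 1 - Pi.single 0 1) := fun i => by
      simp only [v]
      rw [hBrepr]
      funext j
      simp [e, toReal, Pi.single_apply]
    simp only [h1]
    funext j
    simp only [Finset.sum_apply, Pi.smul_apply, Pi.sub_apply, smul_eq_mul]
    have h2 : ∀ i, μ i * (N * ((Pi.single i (1 : ℝ) : Fin (d + 1) → ℝ) j
        - (Pi.single 0 (1 : ℝ) : Fin (d + 1) → ℝ) j)) =
        N * (μ i * (Pi.single i (1 : ℝ) : Fin (d + 1) → ℝ) j)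
          - N * (μ i * (Pi.single 0 (1 : ℝ) : Fin (d + 1) → ℝ) j) := fun i => by ring
    simp only [h2, Finset.sum_sub_distrib, ← Finset.mul_sum, ← Finset.sum_mul]
    simp only [Pi.single_apply, mul_ite, mul_one, mul_zero, Finset.sum_ite_eq, Finset.mem_univ,
      if_true]
    split_ifs <;> ring
  have hv : AffineIndependent ℝ (fun i => toReal (v i)) := by
    rw [affineIndependent_iff_homog]
    intro μ hμ
    have h1 := hBv μ
    rw [hμ] at h1
    simp only [Prod.fst_zero, Prod.snd_zero, map_zero, zero_smul, sub_zero] at h1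
    exact (smul_eq_zero.mp h1.symm).resolve_left hNr
  refine ⟨v, hv, le_antisymm ?_ ?_⟩
  · rintro μ ⟨z, h, hz⟩
    have h1 := hBv μ
    rw [hz, hB] at h1
    obtain ⟨-, z', t, hzt⟩ := (∑ j, z j • b j : scaledKernel N q).2
    refine ⟨fun j => z' j + h * (Pi.single 0 1 : Fin (d + 1) → ℤ) j, t, fun i => ?_⟩
    have h2 := congrFun h1 i
    simp only [toReal, hzt, Pi.smul_apply, Pi.sub_apply, smul_eq_mul] at h2
    rw [← mul_one_div (t : ℝ), ← hqr i]
    push_cast at h2 ⊢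
    have h3 : ((Pi.single 0 (1 : ℤ) : Fin (d + 1) → ℤ) i : ℝ) =
      (Pi.single 0 (1 : ℝ) : Fin (d + 1) → ℝ) i := by simp [Pi.single_apply]
    rw [h3]
    field_simp
    linarith
  · have hg : (fun i => (1 : ℝ) / m i) ∈ coordLattice v := by
      have hsum : ∑ i, q i = N * r := by
        have h1 : (∑ i, q i : ℝ) = N * r := by
          rw [← hr, Finset.mul_sum]
          refine Finset.sum_congr rfl fun i _ => ?_
          rw [← hqr]
          field_simp
        exact_mod_cast h1
      -- N times the vector (1 / m i) - r • e_0, which has sum zero because the inverses add up to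
      -- the integer r.
      let x : scaledKernel N q := ⟨q - (N * r) • Pi.single 0 1, by
          simp [Finset.sum_sub_distrib, hsum, ← Finset.mul_sum],
        -(r • Pi.single 0 1), 1, fun i => by simp; ring⟩
      have hx : N • x = ∑ i, q i • e i := by
        apply Subtype.ext
        rw [AddSubmonoidClass.coe_finsetSum]
        funext j
        simp only [x, e, SetLike.val_smul, Finset.sum_apply, Pi.smul_apply, Pi.sub_apply,
          smul_eq_mul]
        have h2 : ∀ i, q i * (N * ((Pi.single i (1 : ℤ) : Fin (d + 1) → ℤ) j
            - (Pi.single 0 (1 : ℤ) : Fin (d + 1) → ℤ) j)) =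
            N * (q i * (Pi.single i (1 : ℤ) : Fin (d + 1) → ℤ) j)
              - N * (q i * (Pi.single 0 (1 : ℤ) : Fin (d + 1) → ℤ) j) := fun i => by ring
        simp only [h2, Finset.sum_sub_distrib, ← Finset.mul_sum, ← Finset.sum_mul, hsum]
        simp only [Pi.single_apply, mul_ite, mul_one, mul_zero, Finset.sum_ite_eq, Finset.mem_univ,
          if_true]
        split_ifs <;> ring
      refine ⟨b.repr x, r, Prod.ext ?_ hr⟩
      rw [homog_apply]
      simp only
      have h1 : N • (b.repr x : Fin d → ℤ) = ∑ i, q i • v i := by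
        have h2 := congrArg (fun y => (b.repr y : Fin d → ℤ)) hx
        simp only [map_smul, map_sum] at h2
        rw [Finsupp.coe_smul, Finsupp.coe_finsetSum] at h2
        exact h2
      have h2 := congrArg toReal h1
      rw [toReal_zsmul, toReal_sum] at h2
      simp only [toReal_zsmul] at h2
      rw [← inv_smul_smul₀ hNr (toReal (b.repr x)), h2, Finset.smul_sum]
      refine Finset.sum_congr rfl fun i _ => ?_
      rw [← hqr, smul_smul]
      congr 1
      field_simp
    rintro μ ⟨z, t, h⟩
    have h1 : μ = (fun i => (z i : ℝ)) + t • fun i => (1 : ℝ) / m i := by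
      funext i
      rw [h i]
      simp [div_eq_mul_inv]
    rw [h1]
    exact add_mem (intCast_mem_coordLattice v z) (zsmul_mem hg t)

end Existence

/-! ### Lattice pyramids and the denominator 1 -/

section Pyramid

theorem convexHull_insert_convexHull {E : Type*} [AddCommGroup E] [Module ℝ E] (a : E)
    (s : Set E) : convexHull ℝ (insert a (convexHull ℝ s)) = convexHull ℝ (insert a s) := by
  apply Set.Subset.antisymm
  · refine convexHull_min (Set.insert_subset
      (subset_convexHull ℝ _ (Set.mem_insert a s)) ?_) (convex_convexHull ℝ _)
    exact convexHull_mono (Set.subset_insert a s)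
  · exact convexHull_mono (Set.insert_subset_insert (subset_convexHull ℝ s))

/-- The inclusion of `ℝ^d` as the hyperplane `x_d = 0` of `ℝ^(d+1)`. -/
def snocZero (d : ℕ) : (Fin d → ℝ) →ₗ[ℝ] (Fin (d + 1) → ℝ) where
  toFun x := Fin.snoc (α := fun _ => ℝ) x 0
  map_add' x y := by
    funext i
    refine Fin.lastCases ?_ (fun j => ?_) i <;> simp
  map_smul' c x := by
    funext i
    refine Fin.lastCases ?_ (fun j => ?_) i <;> simp

theorem pyramid_convexHull (s : Set (Fin d → ℝ)) :
    pyramid (convexHull ℝ s) = convexHull ℝ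
      (insert (Pi.single (Fin.last d) (1 : ℝ)) (snocZero d '' s)) := by
  have h : (fun x : Fin d → ℝ => (Fin.snoc x (0 : ℝ) : Fin (d + 1) → ℝ)) '' convexHull ℝ s =
      convexHull ℝ (snocZero d '' s) := (snocZero d).image_convexHull s
  unfold pyramid
  rw [h, convexHull_insert_convexHull]

/-- The vertices of the pyramid over a simplex, with the apex at the place `i₀`. -/
def pyramidVertices (i₀ : Fin (d + 2)) (v : Fin (d + 1) → Fin d → ℤ) :
    Fin (d + 2) → Fin (d + 1) → ℤ :=
  i₀.insertNth (α := fun _ => Fin (d + 1) → ℤ) (Pi.single (Fin.last d) 1)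
    fun j => Fin.snoc (α := fun _ => ℤ) (v j) 0

theorem toReal_single_last : toReal (Pi.single (Fin.last d) (1 : ℤ)) = Pi.single (Fin.last d) 1 := by
  funext i
  simp [toReal, Pi.single_apply]

theorem toReal_snoc (x : Fin d → ℤ) :
    toReal (Fin.snoc (α := fun _ => ℤ) x 0) = snocZero d (toReal x) := by
  funext i
  refine Fin.lastCases ?_ (fun j => ?_) i <;> simp [toReal, snocZero]

theorem convexHull_pyramidVertices (i₀ : Fin (d + 2)) (v : Fin (d + 1) → Fin d → ℤ) :
    convexHull ℝ (Set.range fun i => toReal (pyramidVertices i₀ v i)) =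
      pyramid (convexHull ℝ (Set.range fun i => toReal (v i))) := by
  rw [pyramid_convexHull]
  congr 1
  ext x
  simp only [Set.mem_range, Set.mem_insert_iff, Set.mem_image, exists_exists_eq_and]
  constructor
  · rintro ⟨i, rfl⟩
    refine Fin.succAboveCases i₀ ?_ (fun j => ?_) i
    · left
      rw [pyramidVertices, Fin.insertNth_apply_same, toReal_single_last]
    · right
      refine ⟨j, ?_⟩
      rw [pyramidVertices, Fin.insertNth_apply_succAbove, toReal_snoc]
  · rintro (rfl | ⟨j, rfl⟩)
    · refine ⟨i₀, ?_⟩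
      rw [pyramidVertices, Fin.insertNth_apply_same, toReal_single_last]
    · refine ⟨i₀.succAbove j, ?_⟩
      rw [pyramidVertices, Fin.insertNth_apply_succAbove, toReal_snoc]

theorem homog_pyramidVertices (i₀ : Fin (d + 2)) (v : Fin (d + 1) → Fin d → ℤ)
    (μ : Fin (d + 2) → ℝ) : homog (pyramidVertices i₀ v) μ =
      (Fin.snoc (α := fun _ => ℝ) (homog v fun j => μ (i₀.succAbove j)).1 (μ i₀),
        μ i₀ + (homog v fun j => μ (i₀.succAbove j)).2) := by
  rw [homog_apply, homog_apply, Fin.sum_univ_succAbove _ i₀, Fin.sum_univ_succAbove _ i₀]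
  refine Prod.ext ?_ rfl
  simp only [pyramidVertices, Fin.insertNth_apply_same, Fin.insertNth_apply_succAbove,
    toReal_single_last, toReal_snoc]
  simp only [← map_smul, ← map_sum]
  funext i
  refine Fin.lastCases ?_ (fun j => ?_) i
  · simp [snocZero]
  · simp [snocZero]

theorem isLatticePolytope_convexHull_range {n : ℕ} (v : Fin (n + 1) → Fin d → ℤ) :
    IsLatticePolytope (convexHull ℝ (Set.range fun i => toReal (v i))) := by
  classical
  refine ⟨Finset.univ.image v, Finset.univ_nonempty.image v, ?_⟩
  rw [Finset.coe_image, Finset.coe_univ, Set.image_univ, ← Set.range_comp]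
  rfl

/-- If one of the denominators is `1`, the simplex is a lattice pyramid. -/
theorem isLatticePyramid_of_eq_one {v : Fin (d + 2) → Fin (d + 1) → ℤ}
    (hv : AffineIndependent ℝ fun i => toReal (v i)) {m : Fin (d + 2) → ℕ} (hm : ∀ i, 0 < m i)
    (hvm : coordLattice v = refLattice m) {i₀ : Fin (d + 2)} (hi₀ : m i₀ = 1) :
    IsLatticePyramid (convexHull ℝ (Set.range fun i => toReal (v i))) := by
  obtain ⟨_, r, hr⟩ := hvm.ge (inv_mem_refLattice m)
  have hr := congrArg Prod.snd hr
  simp only [homog_apply] at hr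
  rw [Fin.sum_univ_succAbove _ i₀, hi₀] at hr
  -- The remaining inverses still have an integral sum, so they belong to a simplex of one dimension
  -- less. The pyramid over it has the given coordinate lattice.
  obtain ⟨v', hv', hvm'⟩ := exists_simplex_of_denominators (fun j => m (i₀.succAbove j))
    (fun j => hm _) (r := r - 1) (by push_cast at hr ⊢; linarith)
  refine ⟨convexHull ℝ (Set.range fun i => toReal (v' i)), isLatticePolytope_convexHull_range v', ?_⟩
  rw [← convexHull_pyramidVertices i₀ v']
  refine unimodularEquiv_of_coordLattice_eq ?_ hv ?_
  · rw [affineIndependent_iff_homog] at hv' ⊢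
    intro μ hμ
    rw [homog_pyramidVertices, Prod.mk_eq_zero] at hμ
    obtain ⟨h1, h2⟩ := hμ
    have h3 : μ i₀ = 0 := by simpa using congrFun h1 (Fin.last d)
    rw [h3, zero_add] at h2
    have h4 : (fun j => μ (i₀.succAbove j)) = 0 := hv' _ (Prod.ext (by
      funext j
      simpa using congrFun h1 j.castSucc) h2)
    funext i
    exact Fin.succAboveCases i₀ h3 (fun j => congrFun h4 j) i
  · rw [hvm]
    ext μ
    rw [mem_coordLattice, homog_pyramidVertices]
    constructor
    · rintro ⟨z, h, hz⟩
      rw [Prod.mk.injEq] at hz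
      obtain ⟨h1, h2⟩ := hz
      have h3 : μ i₀ = z (Fin.last d) := by simpa [toReal] using congrFun h1 (Fin.last d)
      have h4 : (fun j => μ (i₀.succAbove j)) ∈ coordLattice v' := by
        refine ⟨fun j => z j.castSucc, h - z (Fin.last d), Prod.ext ?_ ?_⟩
        · funext j
          simpa [toReal] using congrFun h1 j.castSucc
        · push_cast
          rw [← h3]
          linarith
      rw [hvm'] at h4
      obtain ⟨z', t, hz'⟩ := h4
      refine ⟨i₀.insertNth (α := fun _ => ℤ) (z (Fin.last d) - t) z', t, ?_⟩
      intro i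
      refine Fin.succAboveCases i₀ ?_ (fun j => ?_) i
      · rw [h3, hi₀, Fin.insertNth_apply_same]
        push_cast
        ring
      · rw [Fin.insertNth_apply_succAbove]
        exact hz' j
    · rintro ⟨z, t, hz⟩
      have h4 : (fun j => μ (i₀.succAbove j)) ∈ coordLattice v' := by
        rw [hvm']
        exact ⟨fun j => z (i₀.succAbove j), t, fun j => hz _⟩
      obtain ⟨z', h, hz'⟩ := h4
      have h5 := hz i₀
      rw [hi₀] at h5
      refine ⟨Fin.snoc (α := fun _ => ℤ) z' (z i₀ + t), z i₀ + t + h, ?_⟩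
      rw [hz']
      refine Prod.ext ?_ (by simp [h5])
      funext i
      refine Fin.lastCases ?_ (fun j => ?_) i
      · simp [h5, toReal]
      · simp [toReal]

/-- A point of the pyramid lies on a segment from the apex to the base, and its last coordinate is
the weight of the apex. -/
theorem eq_apex_of_last_eq_one {Q : Set (Fin d → ℝ)} {y : Fin (d + 1) → ℝ} (hQ : Q.Nonempty)
    (hc : Convex ℝ Q) (hy : y ∈ pyramid Q) :
    0 ≤ y (Fin.last d) ∧ y (Fin.last d) ≤ 1 ∧
      (y (Fin.last d) = 1 → y = Pi.single (Fin.last d) 1) := by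
  have hS : convexHull ℝ ((fun x : Fin d → ℝ => (Fin.snoc x (0 : ℝ) : Fin (d + 1) → ℝ)) '' Q) =
      snocZero d '' Q := by
    have h1 : (fun x : Fin d → ℝ => (Fin.snoc x (0 : ℝ) : Fin (d + 1) → ℝ)) '' Q =
      snocZero d '' Q := rfl
    rw [h1]
    exact (hc.linear_image (snocZero d)).convexHull_eq
  unfold pyramid at hy
  rw [convexHull_insert (hQ.image _), hS, mem_convexJoin] at hy
  obtain ⟨a, rfl, _, ⟨x, hx, rfl⟩, α, β, hα, hβ, hαβ, rfl⟩ := hy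
  have h1 : (α • (Pi.single (Fin.last d) 1 : Fin (d + 1) → ℝ) + β • snocZero d x) (Fin.last d)
      = α := by simp [snocZero]
  rw [h1]
  refine ⟨hα, by linarith, ?_⟩
  rintro rfl
  have : β = 0 := by linarith
  rw [this, one_smul, zero_smul, add_zero]

/-- If none of the denominators is `1`, the simplex is not a lattice pyramid. -/
theorem not_isLatticePyramid {v : Fin (d + 1) → Fin d → ℤ}
    (hv : AffineIndependent ℝ fun i => toReal (v i)) {m : Fin (d + 1) → ℕ} (hm : ∀ i, 1 < m i)
    (hvm : coordLattice v = refLattice m) :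
    ¬ IsLatticePyramid (convexHull ℝ (Set.range fun i => toReal (v i))) := by
  cases d with
  | zero => exact fun h => h
  | succ d =>
    rintro ⟨Q, ⟨V, hV, rfl⟩, hQ⟩
    obtain ⟨U, w, hU, hP⟩ := (unimodularEquiv_equivalence _).symm hQ
    rw [← convexHull_eq_affineMap_image (homog_affine U w)] at hP
    have hv2 := affineIndependent_affine hv hU w
    have hg := inv_mem_refLattice m
    rw [← hvm, ← coordLattice_affine v hU w] at hg
    set v2 : Fin (d + 2) → Fin (d + 1) → ℤ := fun i => Matrix.vecMul (v i) U + w with hv2def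
    have hne : (convexHull ℝ (toReal '' (V : Set (Fin d → ℤ)))).Nonempty :=
      (Set.Nonempty.image _ hV).convexHull
    have hmem : ∀ i, 0 ≤ toReal (v2 i) (Fin.last d) ∧ toReal (v2 i) (Fin.last d) ≤ 1 ∧
      (toReal (v2 i) (Fin.last d) = 1 → toReal (v2 i) = Pi.single (Fin.last d) 1) := fun i =>
      eq_apex_of_last_eq_one hne (convex_convexHull ℝ _)
        (hP ▸ subset_convexHull ℝ _ (Set.mem_range_self i))
    have h01 : ∀ i, toReal (v2 i) (Fin.last d) = 0 ∨ toReal (v2 i) (Fin.last d) = 1 := fun i => by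
      obtain ⟨h1, h2, -⟩ := hmem i
      simp only [toReal] at h1 h2 ⊢
      have h1 : 0 ≤ v2 i (Fin.last d) := by exact_mod_cast h1
      have h2 : v2 i (Fin.last d) ≤ 1 := by exact_mod_cast h2
      rcases (by omega : v2 i (Fin.last d) = 0 ∨ v2 i (Fin.last d) = 1) with h | h <;> simp [h]
    -- Were the last coordinate 0 at every vertex, the apex could not lie in the hull.
    obtain ⟨i₀, hi₀⟩ : ∃ i, toReal (v2 i) (Fin.last d) = 1 := by
      by_contra hcon
      push Not at hcon
      have hap : (Pi.single (Fin.last d) (1 : ℝ) : Fin (d + 1) → ℝ) ∈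
          convexHull ℝ (Set.range fun i => toReal (v2 i)) := by
        rw [← hP]
        exact subset_convexHull ℝ _ (Set.mem_insert _ _)
      obtain ⟨μ, -, -, h⟩ := (mem_convexHull_range_iff _).mp hap
      have h1 := congrFun h (Fin.last d)
      simp [(h01 _).resolve_right (hcon _)] at h1
    have hother : ∀ i, i ≠ i₀ → toReal (v2 i) (Fin.last d) = 0 := fun i hi =>
      (h01 i).resolve_right fun h1 => hi (hv2.injective
        (((hmem i).2.2 h1).trans ((hmem i₀).2.2 hi₀).symm))
    obtain ⟨z, h, hz⟩ := hg
    have h1 := congrFun (congrArg Prod.fst hz) (Fin.last d)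
    simp only [homog_apply, Finset.sum_apply, Pi.smul_apply, smul_eq_mul] at h1
    -- The lattice point with coordinates 1 / m i has last coordinate 1 / m i₀, as only the apex
    -- contributes. Integrality contradicts m i₀ > 1.
    rw [Finset.sum_eq_single i₀ (fun i _ hi => by rw [hother i hi, mul_zero]) (by simp), hi₀,
      mul_one] at h1
    have h2 : (m i₀ : ℝ) ≠ 0 := by have := hm i₀; positivity
    simp only [toReal] at h1
    field_simp at h1
    have h3 : (1 : ℤ) = m i₀ * z (Fin.last d) := by exact_mod_cast h1
    have h4 := Int.isUnit_iff.mp (IsUnit.of_mul_eq_one _ h3.symm)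
    have := hm i₀
    omega

end Pyramid

/-! ### Reflexivity and denominators -/

section Gorenstein

theorem homog_smul_vertices (r : ℤ) (v : Fin (d + 1) → Fin d → ℤ) (μ : Fin (d + 1) → ℝ) :
    homog (fun i => r • v i) μ = ((r : ℝ) • (homog v μ).1, (homog v μ).2) := by
  refine Prod.ext ?_ rfl
  simp only [homog_apply, toReal_zsmul, Finset.smul_sum]
  exact Finset.sum_congr rfl fun i _ => smul_comm _ _ _

theorem affineIndependent_smul_vertices {r : ℤ} (hr : r ≠ 0) {v : Fin (d + 1) → Fin d → ℤ}
    (hv : AffineIndependent ℝ fun i => toReal (v i)) :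
    AffineIndependent ℝ fun i => toReal (r • v i) := by
  rw [affineIndependent_iff_homog] at hv
  refine affineIndependent_of_homog fun μ hμ => hv μ ?_
  rw [homog_smul_vertices, Prod.mk_eq_zero] at hμ
  refine Prod.ext ?_ hμ.2
  exact (smul_eq_zero.mp hμ.1).resolve_left (by exact_mod_cast hr)

theorem smul_convexHull_range (r : ℤ) (v : Fin (d + 1) → Fin d → ℤ) :
    (r : ℝ) • convexHull ℝ (Set.range fun i => toReal (v i)) =
      convexHull ℝ (Set.range fun i => toReal (r • v i)) := by
  rw [← convexHull_smul, ← Set.image_smul, ← Set.range_comp]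
  simp only [toReal_zsmul]
  rfl

theorem mem_interior_simplex {u : Fin (d + 1) → Fin d → ℤ}
    (hu : AffineIndependent ℝ fun i => toReal (u i)) {x : Fin d → ℝ} :
    x ∈ interior (convexHull ℝ (Set.range fun i => toReal (u i))) ↔
      ∃ μ : Fin (d + 1) → ℝ, (∀ i, 0 < μ i) ∧ homog u μ = (x, 1) := by
  let b : AffineBasis (Fin (d + 1)) ℝ (Fin d → ℝ) :=
    ⟨fun i => toReal (u i), hu, hu.affineSpan_eq_top_iff_card_eq_finrank_add_one.mpr (by simp)⟩
  have h1 : homog u (fun i => b.coord i x) = (x, 1) :=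
    Prod.ext (b.linear_combination_coord_eq_self x) (b.sum_coord_apply_eq_one x)
  have h2 : interior (convexHull ℝ (Set.range fun i => toReal (u i))) =
      {x | ∀ i, 0 < b.coord i x} := b.interior_convexHull
  rw [h2, Set.mem_ofPred_eq]
  constructor
  · exact fun h => ⟨_, h, h1⟩
  · rintro ⟨μ, hμ, h⟩
    rw [← h] at h1
    rw [← homog_injective hu h1] at hμ
    exact hμ

theorem mem_dual_convexHull_iff {s : Set (Fin d → ℝ)} {y : Fin d → ℝ} :
    y ∈ dual (convexHull ℝ s) ↔ ∀ x ∈ s, dotProduct x y ≤ 1 := by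
  constructor
  · exact fun h x hx => h x (subset_convexHull ℝ s hx)
  · intro h x hx
    have hc : Convex ℝ {x : Fin d → ℝ | dotProduct x y ≤ 1} := by
      intro a ha b hb α β hα hβ hαβ
      simp only [Set.mem_ofPred_eq, add_dotProduct, smul_dotProduct, smul_eq_mul] at ha hb ⊢
      calc α * (a ⬝ᵥ y) + β * (b ⬝ᵥ y) ≤ α * 1 + β * 1 := by gcongr
        _ = 1 := by rw [mul_one, mul_one, hαβ]
    exact convexHull_min h hc hx

theorem dotProduct_homog (u : Fin (d + 1) → Fin d → ℤ) (μ : Fin (d + 1) → ℝ) (y : Fin d → ℝ) :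
    dotProduct (homog u μ).1 y = ∑ j, μ j * dotProduct (toReal (u j)) y := by
  simp [homog_apply, sum_dotProduct]

/-- The vertices of the dual of a simplex with the origin in its interior. -/
theorem exists_dual_vertex {u : Fin (d + 1) → Fin d → ℤ}
    (hu : AffineIndependent ℝ fun i => toReal (u i)) {c : Fin (d + 1) → ℝ} (hc : ∀ i, 0 < c i)
    (h0 : homog u c = (0, 1)) (i : Fin (d + 1)) :
    ∃ y : Fin d → ℝ, ∀ μ, dotProduct (homog u μ).1 y = (homog u μ).2 - μ i / c i := by
  let e := LinearEquiv.ofBijective (homog u) ⟨homog_injective hu, homog_surjective hu⟩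
  -- Lift a point to height 0 and take -1 / c i times its i-th coordinate. On the facet opposite to
  -- vertex i this functional is 1.
  let f : (Fin d → ℝ) →ₗ[ℝ] ℝ :=
    ((-(c i)⁻¹) • LinearMap.proj i).comp (e.symm.toLinearMap.comp (LinearMap.inl ℝ _ ℝ))
  refine ⟨fun a => f (Pi.single a 1), fun μ => ?_⟩
  have h1 : ∀ x : Fin d → ℝ, dotProduct x (fun a => f (Pi.single a 1)) = f x := fun x => by
    rw [LinearMap.pi_apply_eq_sum_univ f x]
    simp only [dotProduct, smul_eq_mul]
    refine Finset.sum_congr rfl fun a _ => ?_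
    congr 2
    funext b
    simp [Pi.single_apply, eq_comm]
  rw [h1]
  have h2 : e.symm ((homog u μ).1, 0) = μ - (homog u μ).2 • c := by
    rw [LinearEquiv.symm_apply_eq]
    change _ = homog u _
    rw [map_sub, map_smul, h0]
    exact Prod.ext (by simp) (by simp)
  have h3 : f (homog u μ).1 = -(c i)⁻¹ * (e.symm ((homog u μ).1, 0)) i := rfl
  rw [h3, h2]
  have := (hc i).ne'
  simp only [Pi.sub_apply, Pi.smul_apply, smul_eq_mul]
  field_simp
  ring

theorem toReal_dotProduct (x y : Fin d → ℤ) :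
    dotProduct (toReal x) (toReal y) = ((dotProduct x y : ℤ) : ℝ) := by
  simp [dotProduct, toReal]

/-- The integral dual vertices of a reflexive simplex. -/
theorem exists_integral_dual_vertex {u : Fin (d + 1) → Fin d → ℤ}
    (hu : AffineIndependent ℝ fun i => toReal (u i)) {c : Fin (d + 1) → ℝ} (hc : ∀ i, 0 < c i)
    (h0 : homog u c = (0, 1))
    (hdual : IsLatticePolytope (dual (convexHull ℝ (Set.range fun i => toReal (u i)))))
    (i : Fin (d + 1)) :
    ∃ a : Fin d → ℤ, (∀ j, j ≠ i → dotProduct (u j) a = 1) ∧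
      ∀ μ, dotProduct (homog u μ).1 (toReal a) = (homog u μ).2 - μ i / c i := by
  obtain ⟨y, hy⟩ := exists_dual_vertex hu hc h0 i
  have huy : ∀ j, dotProduct (toReal (u j)) y = 1 - (Pi.single j 1 : Fin (d + 1) → ℝ) i / c i :=
    fun j => by
      have := hy (Pi.single j 1)
      rwa [homog_single] at this
  have hyd : y ∈ dual (convexHull ℝ (Set.range fun i => toReal (u i))) := by
    rw [mem_dual_convexHull_iff]
    rintro _ ⟨j, rfl⟩
    rw [huy]
    have h1 : 0 ≤ (Pi.single j 1 : Fin (d + 1) → ℝ) i := by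
      rw [Pi.single_apply]; split_ifs <;> norm_num
    have := div_nonneg h1 (hc i).le
    linarith
  obtain ⟨W, -, hW⟩ := hdual
  have hWd : ∀ a ∈ W, ∀ j, dotProduct (toReal (u j)) (toReal a) ≤ 1 := fun a ha j => by
    have h1 : toReal a ∈ dual (convexHull ℝ (Set.range fun i => toReal (u i))) := by
      rw [hW]
      exact subset_convexHull ℝ _ ⟨a, ha, rfl⟩
    exact mem_dual_convexHull_iff.mp h1 _ ⟨j, rfl⟩
  rw [hW] at hyd
  have himg : toReal '' (W : Set (Fin d → ℤ)) = Set.range fun a : W => toReal a.1 := by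
    ext x
    simp
  rw [himg] at hyd
  obtain ⟨α, hα0, hα1, hα⟩ := (mem_convexHull_range_iff _).mp hyd
  obtain ⟨a, ha⟩ : ∃ a, 0 < α a := by
    by_contra hcon
    push Not at hcon
    have : ∑ a, α a ≤ 0 := Finset.sum_nonpos fun a _ => hcon a
    linarith
  -- Pairing with u j is at most 1 on W and equal to 1 at the convex combination y, hence equal to 1
  -- at each point of positive weight.
  have hone : ∀ j, j ≠ i → dotProduct (toReal (u j)) (toReal a.1) = 1 := by
    intro j hj
    have h1 : ∑ b, α b * (1 - dotProduct (toReal (u j)) (toReal b.1)) = 0 := by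
      have h2 := huy j
      rw [Pi.single_eq_of_ne hj.symm, zero_div, sub_zero, ← hα, dotProduct_sum] at h2
      simp only [dotProduct_smul, smul_eq_mul] at h2
      simp only [mul_sub, mul_one, Finset.sum_sub_distrib, hα1, h2, sub_self]
    have h2 := (Finset.sum_eq_zero_iff_of_nonneg fun b _ =>
      mul_nonneg (hα0 b) (sub_nonneg.mpr (hWd b.1 b.2 j))).mp h1 a (Finset.mem_univ a)
    have := (mul_eq_zero.mp h2).resolve_left ha.ne'
    linarith
  refine ⟨a.1, fun j hj => ?_, fun μ => ?_⟩
  · have := hone j hj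
    rw [toReal_dotProduct] at this
    exact_mod_cast this
  · have hsum : ∀ ν : Fin (d + 1) → ℝ, dotProduct (homog u ν).1 (toReal a.1) =
        (homog u ν).2 + ν i * (dotProduct (toReal (u i)) (toReal a.1) - 1) := by
      intro ν
      have h1 : ∀ j, ν j * dotProduct (toReal (u j)) (toReal a.1) = ν j +
          if j = i then ν i * (dotProduct (toReal (u i)) (toReal a.1) - 1) else 0 := fun j => by
        split_ifs with h
        · subst h; ring
        · rw [hone j h]; ring
      rw [dotProduct_homog]
      simp only [h1, Finset.sum_add_distrib]
      simp [homog_apply]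
    -- The coordinates c of the origin determine the one remaining value, at u i.
    have h1 := hsum c
    rw [h0, zero_dotProduct] at h1
    have h2 : dotProduct (toReal (u i)) (toReal a.1) - 1 = -(1 / c i) := by
      have := (hc i).ne'
      field_simp
      simp only at h1
      linarith
    rw [hsum, h2]
    ring

/-- The barycentric coordinates of the lattice points of a Gorenstein simplex. -/
theorem exists_denominators_of_isGorenstein (hd : 0 < d) {v : Fin (d + 1) → Fin d → ℤ}
    (hv : AffineIndependent ℝ fun i => toReal (v i))
    (hG : IsGorenstein (convexHull ℝ (Set.range fun i => toReal (v i)))) :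
    ∃ m : Fin (d + 1) → ℕ, (∀ i, 0 < m i) ∧ (fun i => (1 : ℝ) / m i) ∈ coordLattice v ∧
      ∀ μ ∈ coordLattice v, ∀ i, ∃ c : ℤ, μ i = c / m i := by
  obtain ⟨r, hr, Q, ⟨-, h0, hdual⟩, U, w, hU, rfl⟩ := hG
  have hr0 : (r : ℤ) ≠ 0 := by positivity
  have hrr : (0 : ℝ) < r := by positivity
  have hrv := affineIndependent_smul_vertices hr0 hv
  have hu := affineIndependent_affine hrv hU w
  rw [← Int.cast_natCast (R := ℝ) r, smul_convexHull_range,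
    ← convexHull_eq_affineMap_image (homog_affine U w)] at h0 hdual
  have hform := fun μ => homog_affine (v := fun i => (r : ℤ) • v i) U w μ
  simp only [homog_smul_vertices] at hform
  set u : Fin (d + 1) → Fin d → ℤ := fun i => Matrix.vecMul ((r : ℤ) • v i) U + w with hudef
  obtain ⟨c, hc, hc0⟩ := (mem_interior_simplex hu).mp h0
  choose a ha1 ha using exists_integral_dual_vertex hu hc hc0 hdual
  -- Pair the image of μ with the integral dual vertex a i. A vertex j ≠ i, available since d > 0,
  -- expresses ⟨w, a i⟩ as 1 minus a multiple of r. The terms h cancel and μ i / c i is r times an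
  -- integer.
  have hmain : ∀ μ ∈ coordLattice v, ∀ i, ∃ b : ℤ, μ i = (r * c i) * b := by
    rintro μ ⟨z, h, hz⟩ i
    have : Nontrivial (Fin (d + 1)) := Fin.nontrivial_iff_two_le.mpr (by omega)
    obtain ⟨j, hj⟩ := exists_ne i
    have h1 := ha1 i j hj
    simp only [add_dotProduct, Matrix.smul_vecMul, smul_dotProduct, smul_eq_mul] at h1
    have h2 := ha i μ
    rw [hform, hz] at h2
    have h3 : Matrix.vecMul ((r : ℤ) • toReal z) (U.map (Int.cast : ℤ → ℝ)) =
        (r : ℝ) • toReal (Matrix.vecMul z U) := by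
      funext j
      simp [toReal, Matrix.vecMul, dotProduct, Finset.mul_sum, mul_assoc]
    have h3' : Matrix.vecMul (((r : ℤ) : ℝ) • toReal z) (U.map (Int.cast : ℤ → ℝ)) =
        (r : ℝ) • toReal (Matrix.vecMul z U) := by
      rw [← h3]
      congr 1
      funext j
      simp
    simp only [h3', add_dotProduct, smul_dotProduct, toReal_dotProduct, smul_eq_mul] at h2
    have h4 : dotProduct w (a i) = 1 - r * dotProduct (Matrix.vecMul (v j) U) (a i) := by
      linarith
    rw [h4] at h2
    push_cast at h2
    refine ⟨h * dotProduct (Matrix.vecMul (v j) U) (a i) - dotProduct (Matrix.vecMul z U) (a i), ?_⟩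
    have h5 := (hc i).ne'
    have h6 : μ i = (μ i / c i) * c i := by field_simp
    rw [h6]
    push_cast
    have h7 : μ i / c i = h - (r * (dotProduct (Matrix.vecMul z U) (a i) : ℤ) +
      h * (1 - r * (dotProduct (Matrix.vecMul (v j) U) (a i) : ℤ))) := by linarith
    rw [h7]
    ring
  -- The i-th unit vector lies in the lattice, so 1 is an integral multiple of r * c i.
  have hm : ∀ i, ∃ m : ℕ, 0 < m ∧ (r * c i) * m = 1 := fun i => by
    obtain ⟨b, hb⟩ := hmain _ (intCast_mem_coordLattice v (Pi.single i 1)) i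
    rw [Pi.single_eq_same, Int.cast_one] at hb
    have hpos : 0 < r * c i := mul_pos hrr (hc i)
    have hb0 : (0 : ℝ) < b := by
      by_contra hcon
      have := mul_nonpos_of_nonneg_of_nonpos hpos.le (not_lt.mp hcon)
      linarith
    have hb0' : 0 < b := by exact_mod_cast hb0
    obtain ⟨m, rfl⟩ := Int.eq_ofNat_of_zero_le hb0'.le
    exact ⟨m, by exact_mod_cast hb0', by exact_mod_cast hb.symm⟩
  choose m hm0 hm1 using hm
  have hinv : ∀ i, (1 : ℝ) / m i = r * c i := fun i => by
    have : (m i : ℝ) ≠ 0 := by have := hm0 i; positivity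
    field_simp
    linarith [hm1 i]
  refine ⟨m, hm0, ?_, fun μ hμ i => ?_⟩
  · have h1 : (fun i => (1 : ℝ) / m i) = (r : ℝ) • c := funext hinv
    rw [h1]
    -- The lattice point is the preimage of the origin of the reflexive polytope under x ↦ xU + w.
    refine ⟨-Matrix.vecMul w U⁻¹, r, ?_⟩
    have h2 := hform c
    rw [hc0, Prod.mk.injEq] at h2
    obtain ⟨h2, h3⟩ := h2
    rw [← h3, one_smul] at h2
    rw [map_smul]
    refine Prod.ext ?_ (by simp [← h3])
    simp only [Prod.smul_fst]
    have h4 : (U.map (Int.cast : ℤ → ℝ)) * (U⁻¹.map (Int.cast : ℤ → ℝ)) = 1 := by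
      have h5 : (U * U⁻¹).map (Int.cast : ℤ → ℝ)
          = U.map (Int.cast : ℤ → ℝ) * U⁻¹.map (Int.cast : ℤ → ℝ) :=
        Matrix.map_mul (f := Int.castRingHom ℝ)
      rw [← h5, Matrix.mul_nonsing_inv U (Int.isUnit_iff.mpr hU)]
      exact Matrix.map_one _ Int.cast_zero Int.cast_one
    have h5 : (r : ℝ) • (homog v c).1 = Matrix.vecMul (Matrix.vecMul ((r : ℝ) • (homog v c).1)
        (U.map (Int.cast : ℤ → ℝ))) (U⁻¹.map (Int.cast : ℤ → ℝ)) := by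
      rw [Matrix.vecMul_vecMul, h4, Matrix.vecMul_one]
    rw [h5, show Matrix.vecMul ((r : ℝ) • (homog v c).1) (U.map (Int.cast : ℤ → ℝ)) = -toReal w by
      rw [Int.cast_natCast] at h2
      exact eq_neg_of_add_eq_zero_left h2.symm, Matrix.neg_vecMul, toReal_neg]
    congr 1
    funext j
    simp [toReal, Matrix.vecMul, dotProduct]
  · obtain ⟨b, hb⟩ := hmain μ hμ i
    refine ⟨b, ?_⟩
    rw [hb, ← hinv]
    ring

/-- The simplices with a lattice of barycentric coordinates generated by inverses of integers are
Gorenstein. -/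
theorem isGorenstein_of_coordLattice {v : Fin (d + 1) → Fin d → ℤ}
    (hv : AffineIndependent ℝ fun i => toReal (v i)) {m : Fin (d + 1) → ℕ} (hm : ∀ i, 0 < m i)
    (hvm : coordLattice v = refLattice m) :
    IsGorenstein (convexHull ℝ (Set.range fun i => toReal (v i))) := by
  obtain ⟨x, r, hx⟩ := hvm.ge (inv_mem_refLattice m)
  have hsum := congrArg Prod.snd hx
  simp only [homog_apply] at hsum
  have hmr : ∀ i, (0 : ℝ) < m i := fun i => by exact_mod_cast hm i
  have hrpos : (0 : ℝ) < r := by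
    rw [← hsum]
    exact Finset.sum_pos (fun i _ => one_div_pos.mpr (hmr i)) Finset.univ_nonempty
  obtain ⟨r, rfl⟩ := Int.eq_ofNat_of_zero_le (show 0 ≤ r by exact_mod_cast hrpos.le)
  rw [Int.cast_natCast] at hrpos
  have hr1 : 1 ≤ r := by exact_mod_cast hrpos
  have hr0 : (r : ℤ) ≠ 0 := by positivity
  have hdet : (1 : Matrix (Fin d) (Fin d) ℤ).det = 1 ∨
    (1 : Matrix (Fin d) (Fin d) ℤ).det = -1 := Or.inl Matrix.det_one
  have hu := affineIndependent_affine (affineIndependent_smul_vertices hr0 hv) hdet (-x)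
  have hform : ∀ μ, homog (fun i => Matrix.vecMul ((r : ℤ) • v i) (1 : Matrix (Fin d) (Fin d) ℤ)
      + -x) μ = ((r : ℝ) • (homog v μ).1 - (homog v μ).2 • toReal x, (homog v μ).2) := by
    intro μ
    rw [homog_affine, homog_smul_vertices, Matrix.map_one _ Int.cast_zero Int.cast_one,
      Matrix.vecMul_one, toReal_neg, smul_neg, Int.cast_natCast, ← sub_eq_add_neg]
  have hQ := convexHull_eq_affineMap_image (homog_affine (v := fun i => (r : ℤ) • v i)
    (1 : Matrix (Fin d) (Fin d) ℤ) (-x))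
  rw [← smul_convexHull_range, Int.cast_natCast] at hQ
  -- Dilate by r = ∑ 1 / m i and translate the lattice point x with coordinates 1 / m i to the
  -- origin.
  refine ⟨r, hr1, _, ⟨isLatticePolytope_convexHull_range _, ?_, ?_⟩, 1, -x, hdet, hQ⟩
  all_goals
    set u : Fin (d + 1) → Fin d → ℤ :=
      fun i => Matrix.vecMul ((r : ℤ) • v i) (1 : Matrix (Fin d) (Fin d) ℤ) + -x with hudef
    set c : Fin (d + 1) → ℝ := (r : ℝ)⁻¹ • fun i => (1 : ℝ) / m i with hcdef
    have hc : ∀ i, 0 < c i := fun i => mul_pos (inv_pos.mpr hrpos) (one_div_pos.mpr (hmr i))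
    have hc0 : homog u c = (0, 1) := by
      rw [hform, hcdef, map_smul, hx]
      refine Prod.ext ?_ ?_
      · simp [hrpos.ne']
      · simp [hrpos.ne']
  · exact (mem_interior_simplex hu).mpr ⟨c, hc, hc0⟩
  · choose y hy using exists_dual_vertex hu hc hc0
    have hint : ∀ i, ∃ a : Fin d → ℤ, y i = toReal a := by
      intro i
      have h1 : ∀ b, ∃ a : ℤ, y i b = a := fun b => by
        obtain ⟨μ, hμ⟩ := homog_surjective hv (toReal (Pi.single b 1), 0)
        have h2 : μ ∈ coordLattice v := ⟨Pi.single b 1, 0, by rw [hμ]; simp⟩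
        rw [hvm] at h2
        obtain ⟨z, t, hz⟩ := h2
        -- With c i = 1 / (r * m i), coordinate b of the dual vertex is -m i * μ i, where μ
        -- represents the b-th unit vector at height 0.
        refine ⟨-(z i * m i + t), ?_⟩
        have h3 := hy i μ
        rw [hform, hμ, hz i] at h3
        have h4 : toReal (Pi.single b (1 : ℤ)) = Pi.single b 1 := by
          funext j
          simp [toReal, Pi.single_apply]
        simp only [zero_smul, sub_zero, h4, smul_dotProduct, single_dotProduct, one_mul,
          smul_eq_mul, hcdef, Pi.smul_apply] at h3
        have h5 := (hmr i).ne'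
        have h6 := hrpos.ne'
        field_simp at h3
        push_cast
        refine mul_left_cancel₀ h6 ?_
        linarith
      choose a ha using h1
      exact ⟨a, funext ha⟩
    choose a ha using hint
    have hdual : dual (convexHull ℝ (Set.range fun i => toReal (u i))) =
        convexHull ℝ (Set.range fun i => toReal (a i)) := by
      have huy : ∀ i j, dotProduct (toReal (u j)) (y i) =
          1 - (Pi.single j 1 : Fin (d + 1) → ℝ) i / c i := fun i j => by
        have := hy i (Pi.single j 1)
        rwa [homog_single] at this
      ext p
      rw [mem_dual_convexHull_iff, mem_convexHull_range_iff]
      constructor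
      · intro hp
        have hs : ∀ j, 0 ≤ 1 - dotProduct (toReal (u j)) p := fun j =>
          sub_nonneg.mpr (hp _ ⟨j, rfl⟩)
        have hsum1 : ∑ j, c j * (1 - dotProduct (toReal (u j)) p) = 1 := by
          have h1 := dotProduct_homog u c p
          have h2 := congrArg Prod.snd hc0
          rw [hc0, zero_dotProduct] at h1
          simp only [homog_apply] at h2
          simp only [mul_sub, mul_one, Finset.sum_sub_distrib, h2, ← h1, sub_zero]
        -- The weights are the slacks of the inequalities defining the dual, scaled by c. They sum
        -- to 1 because c represents the origin.
        refine ⟨fun j => c j * (1 - dotProduct (toReal (u j)) p),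
          fun j => mul_nonneg (hc j).le (hs j), hsum1, ?_⟩
        have h3 : ∀ q, dotProduct q (∑ j, (c j * (1 - dotProduct (toReal (u j)) p)) • toReal (a j))
            = dotProduct q p := by
          intro q
          obtain ⟨μ, hμ⟩ := homog_surjective hu (q, 0)
          have h4 : ∀ j, dotProduct q (y j) = -(μ j / c j) := fun j => by
            have := hy j μ
            rw [hμ] at this
            simpa using this
          have h5 := dotProduct_homog u μ p
          rw [hμ] at h5
          have h6 := congrArg Prod.snd hμ
          simp only [homog_apply] at h6
          rw [dotProduct_sum]
          simp only [dotProduct_smul, ← ha, h4, smul_eq_mul]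
          have h7 : ∀ j, c j * (1 - dotProduct (toReal (u j)) p) * -(μ j / c j) =
              μ j * dotProduct (toReal (u j)) p - μ j := fun j => by
            have := (hc j).ne'
            field_simp
            ring
          simp only [h7, Finset.sum_sub_distrib, h6, ← h5, sub_zero]
        funext b
        have := h3 (Pi.single b 1)
        rwa [single_one_dotProduct, single_one_dotProduct] at this
      · rintro ⟨α, hα0, hα1, rfl⟩
        rintro _ ⟨j, rfl⟩
        rw [dotProduct_sum, ← hα1]
        refine Finset.sum_le_sum fun i _ => ?_
        simp only [dotProduct_smul, smul_eq_mul, ← ha]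
        refine mul_le_of_le_one_right (hα0 i) ?_
        rw [huy]
        have h1 : 0 ≤ (Pi.single j 1 : Fin (d + 1) → ℝ) i := by
          rw [Pi.single_apply]; split_ifs <;> norm_num
        have := div_nonneg h1 (hc i).le
        linarith
    rw [hdual]
    exact isLatticePolytope_convexHull_range a

end Gorenstein

/-! ### Classes of simplices and admissible multisets -/

section Classification

/-- The integral vectors. -/
def integralVectors (d : ℕ) : AddSubgroup (Fin d → ℝ) where
  carrier := Set.range toReal
  zero_mem' := ⟨0, toReal_zero⟩
  add_mem' := by
    rintro _ _ ⟨x, rfl⟩ ⟨y, rfl⟩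
    exact ⟨x + y, toReal_add x y⟩
  neg_mem' := by
    rintro _ ⟨x, rfl⟩
    exact ⟨-x, toReal_neg x⟩

/-- The finite group attached to a lattice simplex. -/
abbrev simplexGroup (v : Fin (d + 1) → Fin d → ℤ) : Type :=
  coordLattice v ⧸ (integralVectors (d + 1)).addSubgroupOf (coordLattice v)

theorem mk_eq_zero_iff {v : Fin (d + 1) → Fin d → ℤ} (μ : coordLattice v) :
    ((μ : coordLattice v) : simplexGroup v) = 0 ↔ ∃ z, toReal z = (μ : Fin (d + 1) → ℝ) := by
  rw [QuotientAddGroup.eq_zero_iff]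
  exact AddSubgroup.mem_addSubgroupOf

theorem card_simplexGroup (v : Fin (d + 1) → Fin d → ℤ) :
    Nat.card (simplexGroup v) = (box v).ncard := by
  rw [← Nat.card_coe_set_eq]
  symm
  refine Nat.card_congr (Equiv.ofBijective
    (fun μ : box v => ((⟨μ.1, μ.2.1⟩ : coordLattice v) : simplexGroup v)) ⟨?_, ?_⟩)
  · rintro ⟨μ, hμ⟩ ⟨ν, hν⟩ h
    simp only at h
    rw [← sub_eq_zero, ← QuotientAddGroup.mk_sub, mk_eq_zero_iff] at h
    obtain ⟨z, hz⟩ := h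
    have h1 : ∀ i, (z i : ℝ) = μ i - ν i := fun i => congrFun hz i
    apply Subtype.ext
    funext i
    have h2 := hμ.2 i
    have h3 := hν.2 i
    have h4 := h1 i
    have h5 : (z i : ℝ) < 1 := by linarith
    have h6 : (-1 : ℝ) < z i := by linarith
    have h5 : z i < 1 := by exact_mod_cast h5
    have h6 : -1 < z i := by exact_mod_cast h6
    rw [show z i = 0 by omega] at h4
    simp only at h4 ⊢
    push_cast at h4
    linarith
  · intro x
    obtain ⟨⟨μ, hμ⟩, rfl⟩ := QuotientAddGroup.mk_surjective x
    have h1 : (fun i => Int.fract (μ i)) = μ - toReal (fun i => ⌊μ i⌋) := rfl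
    have h2 : (fun i => Int.fract (μ i)) ∈ coordLattice v := by
      rw [h1]
      exact sub_mem hμ (intCast_mem_coordLattice v _)
    refine ⟨⟨fun i => Int.fract (μ i), h2, fun i => ⟨Int.fract_nonneg _, Int.fract_lt_one _⟩⟩, ?_⟩
    simp only
    rw [← sub_eq_zero, ← QuotientAddGroup.mk_sub, mk_eq_zero_iff]
    refine ⟨-fun i => ⌊μ i⌋, ?_⟩
    rw [AddSubgroup.coe_sub, toReal_neg]
    simp only
    rw [h1]
    abel

/-- In the Gorenstein case, if the normalized volume is squarefree, the lattice of barycentric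
coordinates is generated by the integral vectors and the inverses of the denominators. -/
theorem coordLattice_eq_refLattice {v : Fin (d + 1) → Fin d → ℤ} {n : ℕ} (hn : Squarefree n)
    (hbox : (box v).ncard = n) {m : Fin (d + 1) → ℕ} (hm : ∀ i, 0 < m i)
    (hg : (fun i => (1 : ℝ) / m i) ∈ coordLattice v)
    (hgen : ∀ μ ∈ coordLattice v, ∀ i, ∃ c : ℤ, μ i = c / m i) :
    coordLattice v = refLattice m ∧ ∀ i, m i ∣ n := by
  have hcard : Nat.card (simplexGroup v) = n := by rw [card_simplexGroup, hbox]
  have : Finite (simplexGroup v) := Nat.finite_of_card_ne_zero (hcard ▸ hn.ne_zero)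
  have : Fintype (simplexGroup v) := Fintype.ofFinite _
  set g : simplexGroup v := ((⟨_, hg⟩ : coordLattice v) : simplexGroup v) with hgdef
  set E := addOrderOf g with hE
  have hEn : E ∣ n := hcard ▸ addOrderOf_dvd_natCard g
  have hmE : ∀ i, m i ∣ E := by
    have h1 : E • g = 0 := addOrderOf_nsmul_eq_zero g
    rw [hgdef, ← QuotientAddGroup.mk_nsmul, mk_eq_zero_iff] at h1
    obtain ⟨z, hz⟩ := h1
    intro i
    have h2 : (z i : ℝ) = E * (1 / m i) := by
      have := congrFun hz i
      simpa [toReal] using this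
    have h3 : (m i : ℝ) ≠ 0 := by have := hm i; positivity
    field_simp at h2
    have h4 : (E : ℤ) = m i * z i := by
      rw [mul_comm]
      exact_mod_cast h2.symm
    exact_mod_cast Dvd.intro _ h4.symm
  -- Every coordinate is in (1 / m i)ℤ and m i divides the order E of g, so E annihilates the group.
  have hkill : ∀ x : simplexGroup v, E • x = 0 := by
    intro x
    obtain ⟨⟨μ, hμ⟩, rfl⟩ := QuotientAddGroup.mk_surjective x
    rw [← QuotientAddGroup.mk_nsmul, mk_eq_zero_iff]
    choose c hc using hgen μ hμ
    choose q hq using hmE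
    refine ⟨fun i => q i * c i, ?_⟩
    funext i
    have h3 : (m i : ℝ) ≠ 0 := by have := hm i; positivity
    have h4 : (E : ℝ) = m i * q i := by exact_mod_cast hq i
    simp only [toReal, AddSubgroup.coe_nsmul, Pi.smul_apply, nsmul_eq_mul, h4, hc i]
    push_cast
    field_simp
  -- By Cauchy each prime factor of n is the order of an element, hence divides E. Squarefreeness
  -- turns this into n ∣ E, so g generates.
  have hnE : n ∣ E := by
    have hE0 : E ≠ 0 := (addOrderOf_pos g).ne'
    rw [← Nat.prod_primeFactors_of_squarefree hn]
    refine dvd_trans (Finset.prod_dvd_prod_of_subset _ _ _ fun p hp => ?_)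
      (Nat.prod_primeFactors_dvd E)
    have hpp := Nat.prime_of_mem_primeFactors hp
    have : Fact p.Prime := ⟨hpp⟩
    obtain ⟨x, hx⟩ := exists_prime_addOrderOf_dvd_card (G := simplexGroup v) p (by
      rw [← Nat.card_eq_fintype_card, hcard]
      exact Nat.dvd_of_mem_primeFactors hp)
    exact Nat.mem_primeFactors.mpr ⟨hpp, hx ▸ addOrderOf_dvd_of_nsmul_eq_zero (hkill x), hE0⟩
  have hEeq : E = n := Nat.dvd_antisymm hEn hnE
  refine ⟨le_antisymm ?_ ?_, fun i => hEeq ▸ hmE i⟩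
  · intro μ hμ
    have htop : AddSubgroup.zmultiples g = ⊤ := by
      refine AddSubgroup.eq_top_of_card_eq _ ?_
      rw [Nat.card_zmultiples, hcard, ← hE, hEeq]
    have h1 : ((⟨μ, hμ⟩ : coordLattice v) : simplexGroup v) ∈ AddSubgroup.zmultiples g :=
      htop ▸ AddSubgroup.mem_top _
    obtain ⟨t, ht⟩ := AddSubgroup.mem_zmultiples_iff.mp h1
    rw [eq_comm, ← sub_eq_zero, hgdef, ← QuotientAddGroup.mk_zsmul, ← QuotientAddGroup.mk_sub,
      mk_eq_zero_iff] at ht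
    obtain ⟨z, hz⟩ := ht
    refine ⟨z, t, fun i => ?_⟩
    have h2 : (z i : ℝ) = μ i - t • ((1 : ℝ) / m i) := congrFun hz i
    rw [h2, zsmul_eq_mul]
    ring
  · rintro μ ⟨z, t, h⟩
    have h1 : μ = (fun i => (z i : ℝ)) + t • fun i => (1 : ℝ) / m i := by
      funext i
      rw [h i]
      simp [div_eq_mul_inv]
    rw [h1]
    exact add_mem (intCast_mem_coordLattice v z) (zsmul_mem hg t)

theorem height_map_univ {ι : Type*} [Fintype ι] (m : ι → ℕ) (t : ℕ) :
    (height (Finset.univ.val.map m) t : ℝ) = ∑ i, ((t % m i : ℕ) : ℝ) / m i := by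
  rw [height, Multiset.map_map]
  change (((∑ i, ((t % m i : ℕ) : ℚ) / m i : ℚ)) : ℝ) = _
  push_cast
  rfl

/-- An element of the half-open cube in z + t / m has coordinates {t / m j}, and t may be reduced
modulo n since each m j divides n. -/
theorem isAdmissible_of_box {v : Fin (d + 1) → Fin d → ℤ} {n k : ℕ} (hn : 0 < n)
    {m : Fin (d + 1) → ℕ} (hm : ∀ i, 1 < m i) (hmn : ∀ i, m i ∣ n)
    (hvm : coordLattice v = refLattice m)
    (hbox : ∀ i < n, ∃ μ ∈ box v, ∑ j, μ j = (i * k : ℕ)) :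
    IsAdmissible n k (Finset.univ.val.map m) := by
  refine ⟨fun a ha => ?_, fun i hi => ?_⟩
  · obtain ⟨j, -, rfl⟩ := Multiset.mem_map.mp ha
    exact ⟨hm j, hmn j⟩
  · obtain ⟨μ, ⟨hμ, h01⟩, hsum⟩ := hbox i hi
    rw [hvm] at hμ
    obtain ⟨z, t, hz⟩ := hμ
    have hnz : (n : ℤ) ≠ 0 := by positivity
    have ht0 : 0 ≤ t % n := Int.emod_nonneg t hnz
    refine ⟨(t % n).toNat, ?_⟩
    have key : ∀ j, μ j = (((t % n).toNat % m j : ℕ) : ℝ) / m j := by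
      intro j
      have hmj : (0 : ℝ) < m j := by have := hm j; positivity
      have h1 : μ j * m j = ((z j * m j + t : ℤ) : ℝ) := by
        rw [hz j]
        push_cast
        field_simp
      have h2 : 0 ≤ z j * m j + t := by
        have h3 : (0 : ℝ) ≤ ((z j * m j + t : ℤ) : ℝ) := by
          rw [← h1]
          exact mul_nonneg (h01 j).1 hmj.le
        exact_mod_cast h3
      have h3 : z j * m j + t < m j := by
        have h4 : ((z j * m j + t : ℤ) : ℝ) < m j := by
          rw [← h1]
          exact mul_lt_of_lt_one_left hmj (h01 j).2
        exact_mod_cast h4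
      have h4 : (((t % n).toNat % m j : ℕ) : ℤ) = z j * m j + t := by
        push_cast
        rw [Int.toNat_of_nonneg ht0, Int.emod_emod_of_dvd t (by exact_mod_cast hmn j),
          ← Int.emod_eq_of_lt h2 h3, add_comm, Int.add_mul_emod_self_right]
      rw [eq_div_iff hmj.ne', h1, ← h4, Int.cast_natCast]
    have h5 := height_map_univ m (t % n).toNat
    simp only [← key, hsum] at h5
    have h6 : height (Finset.univ.val.map m) (t % n).toNat = ((i * k : ℕ) : ℚ) := by
      exact_mod_cast h5
    rw [h6]
    push_cast
    ring

/-- The box consists of the vectors of fractional parts for t < n, which are distinct because their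
heights are. -/
theorem box_of_isAdmissible {v : Fin (d + 1) → Fin d → ℤ} {n k : ℕ} (hn : 0 < n) (hk : 0 < k)
    {m : Fin (d + 1) → ℕ} (hvm : coordLattice v = refLattice m)
    (h : IsAdmissible n k (Finset.univ.val.map m)) :
    (box v).ncard = n ∧ ∀ i < n, ∃ μ ∈ box v, ∑ j, μ j = (i * k : ℕ) := by
  have hm : ∀ i, 1 < m i ∧ m i ∣ n := fun i =>
    h.1 _ (Multiset.mem_map.mpr ⟨i, Finset.mem_univ i, rfl⟩)
  have hmr : ∀ i, (0 : ℝ) < m i := fun i => by have := (hm i).1; positivity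
  obtain ⟨hidx, hinj⟩ := h.exists_index_and_inj hn hk
  let f : ℕ → Fin (d + 1) → ℝ := fun t i => ((t % m i : ℕ) : ℝ) / m i
  have hf : ∀ t, f t ∈ box v := fun t => by
    refine ⟨?_, fun i => ⟨by positivity, ?_⟩⟩
    · rw [hvm]
      refine ⟨fun i => -((t / m i : ℕ) : ℤ), t, fun i => ?_⟩
      have h1 : (t : ℝ) = m i * ((t / m i : ℕ) : ℝ) + ((t % m i : ℕ) : ℝ) := by
        exact_mod_cast (Nat.div_add_mod t (m i)).symm
      have h2 := (hmr i).ne'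
      simp only [f, Int.cast_neg, Int.cast_natCast]
      field_simp
      linarith
    · rw [div_lt_one (hmr i)]
      exact_mod_cast Nat.mod_lt t (by have := (hm i).1; omega)
  have hbox : box v = f '' (Finset.range n : Set ℕ) := by
    ext μ
    constructor
    · rintro ⟨hμ, h01⟩
      rw [hvm] at hμ
      obtain ⟨z, t, hz⟩ := hμ
      have hnz : (n : ℤ) ≠ 0 := by positivity
      have ht0 : 0 ≤ t % n := Int.emod_nonneg t hnz
      refine ⟨(t % n).toNat, ?_, ?_⟩
      · have := Int.emod_lt_of_pos t (show (0 : ℤ) < n by positivity)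
        rw [Finset.coe_range, Set.mem_Iio]
        omega
      · funext j
        obtain ⟨c, hc⟩ := (hm j).2
        have h2 := (hmr j).ne'
        have h3 : ((t % n).toNat : ℝ) = t - n * (t / n : ℤ) := by
          have h4 : (((t % n).toNat : ℕ) : ℤ) = t - n * (t / n) := by
            rw [Int.toNat_of_nonneg ht0, Int.emod_def]
          exact_mod_cast h4
        have h5 : (((t % n).toNat : ℕ) : ℝ) = m j * (((t % n).toNat / m j : ℕ) : ℝ)
            + (((t % n).toNat % m j : ℕ) : ℝ) := by
          exact_mod_cast (Nat.div_add_mod _ (m j)).symm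
        obtain ⟨q, hq⟩ : ∃ q, q = (t % n).toNat / m j := ⟨_, rfl⟩
        rw [← hq] at h5
        have h6 := (hf (t % n).toNat).2 j
        have h7 : f (t % n).toNat j - μ j =
            ((-(c * (t / n)) - q - z j : ℤ) : ℝ) := by
          simp only [f, hz j]
          push_cast
          have h8 : (n : ℝ) = m j * c := by exact_mod_cast hc
          rw [h8] at h3
          field_simp
          linarith
        have h8 := h01 j
        set w : ℤ := -(c * (t / n)) - q - z j
        have h9 : (w : ℝ) < 1 := by linarith
        have h10 : (-1 : ℝ) < w := by linarith
        have h9 : w < 1 := by exact_mod_cast h9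
        have h10 : -1 < w := by exact_mod_cast h10
        rw [show w = 0 by omega, Int.cast_zero] at h7
        linarith
    · rintro ⟨t, -, rfl⟩
      exact hf t
  have hsum : ∀ t, ∑ i, f t i = (height (Finset.univ.val.map m) t : ℝ) := fun t =>
    (height_map_univ m t).symm
  constructor
  · rw [hbox, Set.InjOn.ncard_image, Set.ncard_coe_finset, Finset.card_range]
    intro s hs t ht hst
    have h1 : (height (Finset.univ.val.map m) s : ℝ) = height (Finset.univ.val.map m) t := by
      rw [← hsum, ← hsum, hst]
    rw [Finset.coe_range, Set.mem_Iio] at hs ht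
    exact (hinj s t (by exact_mod_cast h1)).eq_of_lt_of_lt hs ht
  · intro i hi
    obtain ⟨t, ht⟩ := h.2 i hi
    refine ⟨f t, hf t, ?_⟩
    rw [hsum, ht]
    push_cast
    ring

/-- In dimension 0 the only coordinate is the integral height. This disposes of the case left out by
the Gorenstein argument. -/
theorem ncard_box_zero_le (v : Fin (0 + 1) → Fin 0 → ℤ) : (box v).ncard ≤ 1 := by
  have : box v ⊆ {0} := by
    rintro μ ⟨⟨z, h, hz⟩, h01⟩
    have h1 := congrArg Prod.snd hz
    simp only [homog_apply] at h1
    rw [show ∑ i, μ i = μ 0 from Fin.sum_univ_one μ] at h1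
    have h2 := h01 0
    rw [h1] at h2
    have h3 : 0 ≤ h := by exact_mod_cast h2.1
    have h4 : h < 1 := by exact_mod_cast h2.2
    rw [Set.mem_singleton_iff]
    funext i
    rw [show i = 0 from Fin.fin_one_eq_zero i, h1, show h = 0 by omega]
    simp
  exact (Set.ncard_le_ncard this).trans (Set.ncard_singleton _).le

/-- Vertices and denominators of the simplices to be counted. -/
theorem exists_denominators {n k : ℕ} (hn : Squarefree n) (hn1 : n ≠ 1) (hk : 0 < k)
    (P : GorSimplex n k d) : ∃ (v : Fin (d + 1) → Fin d → ℤ) (m : Fin (d + 1) → ℕ),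
      AffineIndependent ℝ (fun i => toReal (v i)) ∧
      P.1 = convexHull ℝ (Set.range fun i => toReal (v i)) ∧
      coordLattice v = refLattice m ∧ IsAdmissible n k (Finset.univ.val.map m) := by
  obtain ⟨P, ⟨v, hv, rfl⟩, hG, hpyr, hstar⟩ := P
  rw [hasHStarPolynomial_typePolynomial_iff hv hk] at hstar
  obtain ⟨hcard, hht⟩ := hstar
  have hn0 := hn.ne_zero
  cases d with
  | zero =>
    have := ncard_box_zero_le v
    omega
  | succ d =>
    obtain ⟨m, hm, hg, hgen⟩ := exists_denominators_of_isGorenstein (Nat.succ_pos d) hv hG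
    obtain ⟨hvm, hmn⟩ := coordLattice_eq_refLattice hn hcard hm hg hgen
    have hm1 : ∀ i, 1 < m i := fun i => by
      by_contra hcon
      have := hm i
      exact hpyr (isLatticePyramid_of_eq_one hv hm hvm (show m i = 1 by omega))
    exact ⟨v, m, hv, rfl, hvm, isAdmissible_of_box (by omega) hm1 hmn hvm hht⟩

theorem exists_gorSimplex {n k : ℕ} (hn : 0 < n) (hk : 0 < k) {m : Fin (d + 1) → ℕ}
    (h : IsAdmissible n k (Finset.univ.val.map m)) :
    ∃ (P : GorSimplex n k d) (v : Fin (d + 1) → Fin d → ℤ),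
      AffineIndependent ℝ (fun i => toReal (v i)) ∧
      P.1 = convexHull ℝ (Set.range fun i => toReal (v i)) ∧ coordLattice v = refLattice m := by
  have hm : ∀ i, 1 < m i := fun i =>
    (h.1 _ (Multiset.mem_map.mpr ⟨i, Finset.mem_univ i, rfl⟩)).1
  have hm0 : ∀ i, 0 < m i := fun i => zero_lt_one.trans (hm i)
  -- At t = 1 the height is the sum of the inverses, hence integral by admissibility.
  obtain ⟨i, -, hi⟩ := (h.exists_index_and_inj hn hk).1 1
  have hr : ∑ i, (1 : ℝ) / m i = ((k * i : ℕ) : ℤ) := by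
    have h1 := height_map_univ m 1
    rw [hi] at h1
    push_cast at h1 ⊢
    rw [h1]
    refine Finset.sum_congr rfl fun i _ => ?_
    rw [Nat.mod_eq_of_lt (hm i)]
    simp
  obtain ⟨v, hv, hvm⟩ := exists_simplex_of_denominators m hm0 hr
  exact ⟨⟨_, ⟨v, hv, rfl⟩, isGorenstein_of_coordLattice hv hm0 hvm,
    not_isLatticePyramid hv hm hvm, (hasHStarPolynomial_typePolynomial_iff hv hk).mpr
      (box_of_isAdmissible hn hk hvm h)⟩, v, hv, rfl, hvm⟩

/-- Both families have the same sorted rearrangement. -/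
theorem exists_perm_of_map_univ_eq {n : ℕ} {m m' : Fin n → ℕ}
    (h : Finset.univ.val.map m = Finset.univ.val.map m') :
    ∃ σ : Equiv.Perm (Fin n), m' = m ∘ σ := by
  have h1 : List.Perm (List.ofFn m') (List.ofFn m) := by
    rw [← Multiset.coe_eq_coe, ← Fin.univ_val_map, ← Fin.univ_val_map, h]
  have h2 := ((Tuple.sort m').ofFn_comp_perm m').trans
    (h1.trans ((Tuple.sort m).ofFn_comp_perm m).symm)
  have h3 : m' ∘ Tuple.sort m' = m ∘ Tuple.sort m := List.ofFn_injective
    (h2.eq_of_pairwise' (Tuple.monotone_sort m').sortedLE_ofFn.pairwise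
      (Tuple.monotone_sort m).sortedLE_ofFn.pairwise)
  refine ⟨(Tuple.sort m').symm.trans (Tuple.sort m), ?_⟩
  funext i
  have h4 := congrFun h3 ((Tuple.sort m').symm i)
  simpa using h4

/-- The multiset of the denominators. -/
def denominators {n k : ℕ} (hn : Squarefree n) (hn1 : n ≠ 1) (hk : 0 < k) (P : GorSimplex n k d) :
    Multiset ℕ :=
  Finset.univ.val.map (exists_denominators hn hn1 hk P).choose_spec.choose

theorem denominators_spec {n k : ℕ} (hn : Squarefree n) (hn1 : n ≠ 1) (hk : 0 < k)
    (P : GorSimplex n k d) : ∃ (v : Fin (d + 1) → Fin d → ℤ) (m : Fin (d + 1) → ℕ),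
      AffineIndependent ℝ (fun i => toReal (v i)) ∧
      P.1 = convexHull ℝ (Set.range fun i => toReal (v i)) ∧ (∀ i, 0 < m i) ∧
      coordLattice v = refLattice m ∧ denominators hn hn1 hk P = Finset.univ.val.map m := by
  obtain ⟨hv, hP, hvm, hadm⟩ := (exists_denominators hn hn1 hk P).choose_spec.choose_spec
  exact ⟨_, _, hv, hP, fun i => zero_lt_one.trans
    (hadm.1 _ (Multiset.mem_map.mpr ⟨i, Finset.mem_univ i, rfl⟩)).1, hvm, rfl⟩

theorem isAdmissible_denominators {n k : ℕ} (hn : Squarefree n) (hn1 : n ≠ 1) (hk : 0 < k)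
    (P : GorSimplex n k d) : IsAdmissible n k (denominators hn hn1 hk P) :=
  (exists_denominators hn hn1 hk P).choose_spec.choose_spec.2.2.2

theorem denominators_eq {n k : ℕ} (hn : Squarefree n) (hn1 : n ≠ 1) (hk : 0 < k)
    {P P' : GorSimplex n k d} (hPP' : UnimodularEquiv P.1 P'.1)
    {v' : Fin (d + 1) → Fin d → ℤ} {m' : Fin (d + 1) → ℕ} (hm' : ∀ i, 0 < m' i)
    (hv' : AffineIndependent ℝ fun i => toReal (v' i))
    (hP' : P'.1 = convexHull ℝ (Set.range fun i => toReal (v' i)))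
    (hvm' : coordLattice v' = refLattice m') :
    denominators hn hn1 hk P = Finset.univ.val.map m' := by
  obtain ⟨v, m, hv, hP, hm, hvm, hden⟩ := denominators_spec hn hn1 hk P
  rw [hP, hP'] at hPP'
  obtain ⟨σ, rfl⟩ := exists_perm_of_unimodularEquiv hv' hm hm' hvm hvm' hPP'
  rw [hden, ← Multiset.map_map, Multiset.map_univ_val_equiv]

theorem denominators_eq_of_equiv {n k : ℕ} (hn : Squarefree n) (hn1 : n ≠ 1) (hk : 0 < k)
    {P P' : GorSimplex n k d} (hPP' : UnimodularEquiv P.1 P'.1) :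
    denominators hn hn1 hk P = denominators hn hn1 hk P' := by
  obtain ⟨v, m, hv, hP, hm, hvm, hden⟩ := denominators_spec hn hn1 hk P'
  rw [hden]
  exact denominators_eq hn hn1 hk hPP' hm hv hP hvm

theorem unimodularEquiv_of_denominators_eq {n k : ℕ} (hn : Squarefree n) (hn1 : n ≠ 1)
    (hk : 0 < k) {P P' : GorSimplex n k d}
    (h : denominators hn hn1 hk P = denominators hn hn1 hk P') : UnimodularEquiv P.1 P'.1 := by
  obtain ⟨v, m, hv, hP, hm, hvm, hden⟩ := denominators_spec hn hn1 hk P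
  obtain ⟨v', m', hv', hP', hm', hvm', hden'⟩ := denominators_spec hn hn1 hk P'
  rw [hden, hden'] at h
  obtain ⟨σ, rfl⟩ := exists_perm_of_map_univ_eq h
  have hrange : (Set.range fun i => toReal (v i)) = Set.range fun i => toReal ((v ∘ σ) i) :=
    (σ.surjective.range_comp fun i => toReal (v i)).symm
  rw [hP, hP', hrange]
  refine unimodularEquiv_of_coordLattice_eq (hv.comp_embedding σ.toEmbedding) hv' ?_
  rw [hvm']
  ext μ
  obtain ⟨ν, rfl⟩ : ∃ ν, μ = ν ∘ σ := ⟨μ ∘ σ.symm, by funext i; simp⟩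
  rw [mem_coordLattice_comp_perm, hvm, mem_refLattice_comp_perm]

/-- The classes to be counted correspond to the admissible multisets. -/
def classDenominators {n k : ℕ} (hn : Squarefree n) (hn1 : n ≠ 1) (hk : 0 < k)
    (c : GorSimplexClass n k) : {M | IsAdmissible n k M} :=
  Quotient.lift (s := gorSimplexSetoid n k c.1)
    (fun P => (⟨denominators hn hn1 hk P, isAdmissible_denominators hn hn1 hk P⟩ :
      {M | IsAdmissible n k M}))
    (fun _ _ h => Subtype.ext (denominators_eq_of_equiv hn hn1 hk h)) c.2

theorem classDenominators_bijective {n k : ℕ} (hn : Squarefree n) (hn1 : n ≠ 1) (hk : 0 < k) :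
    Function.Bijective (classDenominators hn hn1 hk) := by
  constructor
  · rintro ⟨d, q⟩ ⟨d', q'⟩ h
    induction q using Quotient.inductionOn with
    | _ P =>
    induction q' using Quotient.inductionOn with
    | _ P' =>
    have h1 : denominators hn hn1 hk P = denominators hn hn1 hk P' := congrArg Subtype.val h
    -- The number of denominators is d + 1, so the dimension is recovered from the multiset.
    have h2 := congrArg Multiset.card h1
    simp only [denominators, Multiset.card_map, Finset.card_val, Finset.card_univ,
      Fintype.card_fin, add_left_inj] at h2
    subst h2
    exact congrArg (Sigma.mk d) (Quotient.sound
      (unimodularEquiv_of_denominators_eq hn hn1 hk h1))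
  · rintro ⟨M, hM⟩
    have hM' : IsAdmissible n k M := hM
    -- The empty multiset has only the height 0, but n > 1 requires the height k.
    have hM0 : M ≠ 0 := by
      rintro rfl
      have hn0 := hn.ne_zero
      obtain ⟨t, ht⟩ := hM'.2 1 (by omega)
      simp only [height, Multiset.map_zero, Multiset.sum_zero, Nat.cast_one, mul_one] at ht
      exact hk.ne (by exact_mod_cast ht)
    obtain ⟨d, hd⟩ := Nat.exists_eq_succ_of_ne_zero (Multiset.card_pos.mpr hM0).ne'
    obtain ⟨m, rfl⟩ : ∃ m : Fin (d + 1) → ℕ, Finset.univ.val.map m = M := by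
      refine Quotient.inductionOn M (fun L hL => ?_) hd
      have hL : L.length = d + 1 := hL
      refine ⟨fun i => L.get (i.cast hL.symm), ?_⟩
      rw [Fin.univ_val_map]
      change ((List.ofFn _ : List ℕ) : Multiset ℕ) = (L : Multiset ℕ)
      congr 1
      exact List.ext_getElem (by simp [hL]) fun i h1 h2 => by rw [List.getElem_ofFn]; rfl
    obtain ⟨P, v, hv, hP, hvm⟩ := exists_gorSimplex (Nat.pos_of_ne_zero hn.ne_zero) hk hM'
    refine ⟨⟨d, Quotient.mk _ P⟩, Subtype.ext ?_⟩
    exact denominators_eq hn hn1 hk ((unimodularEquiv_equivalence d).refl P.1) (fun i =>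
      zero_lt_one.trans (hM'.1 _ (Multiset.mem_map.mpr ⟨i, Finset.mem_univ i, rfl⟩)).1) hv hP hvm

end Classification

end GorensteinSimplex

end

/-! ### Products of distinct primes -/

theorem mainTheorem9 (l k : ℕ) (hl : 1 ≤ l) (hk : 1 ≤ k) (p : Fin l → ℕ)
    (hp : ∀ i, (p i).Prime) (hinj : Function.Injective p) :
    Finite (GorensteinSimplex.GorSimplexClass (∏ i, p i) k) ∧
      GorensteinSimplex.numClasses (∏ i, p i) k =
        ∑ s ∈ Finset.Icc 1 l, (Nat.factorial s) ^ 2 * Nat.stirlingSecond l s := by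
  have himg : ∏ i, p i = ∏ q ∈ Finset.univ.image p, q := by
    rw [Finset.prod_image fun i _ j _ h => hinj h]
  have hprime : ∀ q ∈ Finset.univ.image p, q.Prime := by
    intro q hq
    obtain ⟨i, -, rfl⟩ := Finset.mem_image.mp hq
    exact hp i
  have hfac : (∏ i, p i).primeFactors.card = l := by
    rw [himg, Nat.primeFactors_prod hprime, Finset.card_image_of_injective _ hinj]
    simp
  have hn : Squarefree (∏ i, p i) := by
    refine Finset.squarefree_prod_of_pairwise_isCoprime (fun i _ j _ hij => ?_)
      fun i _ => (hp i).prime.squarefree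
    exact Nat.coprime_iff_isRelPrime.mp
      ((Nat.coprime_primes (hp i) (hp j)).mpr fun h => hij (hinj h))
  have hn1 : ∏ i, p i ≠ 1 := by
    intro h
    rw [h, Nat.primeFactors_one, Finset.card_empty] at hfac
    omega
  have e := Equiv.ofBijective _ (GorensteinSimplex.classDenominators_bijective hn hn1 hk)
  obtain ⟨h1, h2⟩ := GorensteinSimplex.ncard_isAdmissible hn hn1 hk
  have : Finite {M | GorensteinSimplex.IsAdmissible (∏ i, p i) k M} := h1
  refine ⟨Finite.of_equiv _ e.symm, ?_⟩
  rw [GorensteinSimplex.numClasses, Nat.card_congr e, Nat.card_coe_set_eq, h2, hfac]
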